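/- Let $\mathcal P$ be a countable set with a map $N:\mathcal P\to\mathbb Z_{>1}$, let $\mathcal M$ be the free abelian monoid generated by $\mathcal P$, and write $\mathfrak m=\sum_{\mathfrak p\in\mathcal P} n_{\mathfrak p}(\mathfrak m)\,\mathfrak p$ for $\mathfrak m\in\mathcal M$, with $n_{\mathfrak p}(\mathfrak m)\in\mathbb Z_{\ge 0}$, almost all of them zero. Extend $N$ to $\mathcal M$ by $N(\mathfrak m)=\prod_{\mathfrak p}N(\mathfrak p)^{n_{\mathfrak p}(\mathfrak m)}$. Let $X\subseteq\mathbb Q$ be a set that contains $N(\mathfrak m)$ for every $\mathfrak m\in\mathcal M$ and contains $x_1/x_2$ whenever $x_1,x_2\in X$ and $x_2\neq 0$ (for example $X=\mathbb Q$, or $X=\{q^z:z\in\mathbb Z\}$ for an integer $q\ge 2$ when all norms are powers of $q$). Assume that for some $\kappa>0$ and $0\le\theta<1$, $$|\{\mathfrak m\in\mathcal M: N(\mathfrak m)\le x\}|=\kappa x+O(x^\theta)\qquad (x\to\infty,\ x\in X).$$ Let $h\ge 2$ be an integer, and for $x\in X$ let $\mathcal S_h(x)$ be the set of all $\mathfrak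 m\in\mathcal M$ with $N(\mathfrak m)\le x$ that are $h$-free, i.e. satisfy $n_{\mathfrak p}(\mathfrak m)\le h-1$ for all $\mathfrak p$. Let $\mathcal A=(a_1,a_2,\ldots)$ be a sequence of complex numbers with $a_1\neq0$ and $$a_i\ll B^i\quad\text{as } i\to\infty,\qquad\text{where } 0<B\le 2^{1-\alpha}\text{ for some }\alpha>0,$$ and put $\omega_{\mathcal A}(\mathfrak m)=\sum_{k\ge1}a_k\,\omega_k(\mathfrak m)$, where $\omega_k(\mathfrak m)$ is the number of $\mathfrak p\in\mathcal P$ with $n_{\mathfrak p}(\mathfrak m)=k$. Then for every $a\in\mathbb R$, $$\lim_{\substack{x\to\infty\\ x\in X}}\frac1{|\mathcal S_h(x)|}\left|\left\{\mathfrak m\in\mathcal S_h(x): N(\mathfrak m)\ge3,\ \operatorname{Re}\left(\frac{\frac1{a_1}\omega_{\mathcal A}(\mathfrak m)-\log\log N(\mathfrak m)}{\sqrt{\log\log N(\mathfrak m)}}\right)\le a\right\}\right|=\Phi(a):=\frac1{\sqrt{2\pi}}\int_{-\infty}^{a}e^{-u^2/2}\,du.$$ (If all the ratios $a_i/a_1$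 are real, in particular if $\mathcal A$ is real, the quotient is itself real and $\operatorname{Re}$ may be omitted.) -/

import Mathlib

open Filter Topology Asymptotics

namespace AbelianMonoid

/-- The extension of a norm map `N` on a set `P` of prime elements to the free abelian monoid
`P →₀ ℕ` generated by `P`; the multiplicity of `p` in `m` is `m p`. -/
def norm {P : Type*} (N : P → ℕ) (m : P →₀ ℕ) : ℕ :=
  m.prod fun p n => N p ^ n

/-- The elements of `S` of norm at most `x`. -/
def upTo {P : Type*} (N : P → ℕ) (S : Set (P →₀ ℕ)) (x : ℚ) : Set (P →₀ ℕ) :=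
  {m | m ∈ S ∧ (norm N m : ℚ) ≤ x}

/-- The filter `x → ∞`, `x ∈ X`. -/
def atTopIn (X : Set ℚ) : Filter ℚ := atTop ⊓ 𝓟 X

/-- The admissible ranges `X` of the variable `x`: subsets of `ℚ` that contain all the norms and
are closed under division. -/
structure IsRange {P : Type*} (N : P → ℕ) (X : Set ℚ) : Prop where
  norm_mem : ∀ m : P →₀ ℕ, (norm N m : ℚ) ∈ X
  div_mem : ∀ x₁ ∈ X, ∀ x₂ ∈ X, x₂ ≠ 0 → x₁ / x₂ ∈ X

/-- The number of elements of norm at most `x` is `κ x + O(x ^ θ)` for `x ∈ X`, for some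
`κ > 0` and `0 ≤ θ < 1`. (An infinite set has `ncard` equal to `0`, so the condition
forces the sets counted here to be finite as soon as `X` is unbounded.) -/
def CountingCondition {P : Type*} (N : P → ℕ) (X : Set ℚ) : Prop :=
  ∃ κ θ : ℝ, 0 < κ ∧ 0 ≤ θ ∧ θ < 1 ∧
    (fun x : ℚ => ((upTo N Set.univ x).ncard : ℝ) - κ * (x : ℝ))
      =O[atTopIn X] fun x : ℚ => (x : ℝ) ^ θ

/-- The set of `h`-free elements: every multiplicity is at most `h - 1`. -/
def hFree (P : Type*) (h : ℕ) : Set (P →₀ ℕ) :=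
  {m | ∀ p ∈ m.support, m p < h}

/-- The number of prime elements occurring in `m` with multiplicity exactly `k` (for `k ≥ 1`). -/
def omegaMult {P : Type*} (k : ℕ) (m : P →₀ ℕ) : ℕ :=
  (m.support.filter fun p => m p = k).card

/-- The generalized omega function of a sequence `A = (A 1, A 2, …)`; the value `A 0` is not
used. -/
noncomputable def omegaSeq {P : Type*} (A : ℕ → ℂ) (m : P →₀ ℕ) : ℂ :=
  ∑ᶠ (k : ℕ) (_ : 1 ≤ k), A k * (omegaMult k m : ℂ)

/-- For each `m`, only finitely many terms of the sum defining `omegaSeq A m` are non-zero. -/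
theorem omegaSeq_finite {P : Type*} (A : ℕ → ℂ) (m : P →₀ ℕ) :
    {k : ℕ | A k * (omegaMult k m : ℂ) ≠ 0}.Finite := by
  refine (m.support.image m).finite_toSet.subset ?_
  intro k hk
  have hne : omegaMult k m ≠ 0 := by
    intro h0
    exact hk (by simp [h0])
  obtain ⟨p, hp⟩ := Finset.card_pos.mp (Nat.pos_of_ne_zero hne)
  rw [Finset.mem_filter] at hp
  exact Finset.mem_coe.mpr (Finset.mem_image.mpr ⟨p, hp.1, hp.2⟩)

/-- The standard normal distribution function. -/
noncomputable def Phi (a : ℝ) : ℝ :=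
  1 / √(2 * Real.pi) * ∫ u in Set.Iic a, Real.exp (-u ^ 2 / 2)

/-- The normalization `(g(m) - log log N(m)) / √(log log N(m))` of a complex-valued `g`. -/
noncomputable def normalized {P : Type*} (N : P → ℕ) (g : (P →₀ ℕ) → ℂ) (m : P →₀ ℕ) : ℂ :=
  (g m - (Real.log (Real.log (norm N m)) : ℂ)) / (√(Real.log (Real.log (norm N m))) : ℂ)

end AbelianMonoid

namespace AbelianMonoid

/-! The proof is by characteristic functions. Write T = log log x and ω(m) for the number of primes
dividing m. For a random m of norm at most x, the events p | m behave like independent events of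
probability 1/N(p), so ω should be nearly Poisson with mean Σ 1/N(p), which is T + O(log T), and
hence asymptotically normal.

To make this precise, put w = exp(is) - 1 with s of order 1/√T. Then exp(isω) is a product of
factors 1 + w·1[p | m]. Keep only the primes up to x^(1/T): the others number O(log T) = o(√T) on
average. Expand the product and stop at a degree K of order √T. Since |w| is also of order 1/√T, the
truncation error is negligible. The surviving terms are counts of multiples, with total error
x^(θ-1+O(1/√T)). Replacing counts by densities gives the independent model, which differs from the
Poisson exponential by O(|w|²). This is `RegularCount.norm_mean_exp_card_support_sub_le`, and
`RegularCount.tendsto_mean_exp` takes the limit. The estimate for Σ 1/N(p),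
`RegularCount.exists_abs_recipSum_sub_le`, comes from the size of the zeta function near 1.

The restriction to h-free elements is by Möbius inversion. The multiples of a fixed e carry the
share 1/N(e) of the limit, and the sum over e = h·d converges absolutely, so the Gaussian is only
multiplied by a nonzero density (`RegularCount.exists_tendsto_sum_hFreeBox`).

On h-free elements, the generalized omega function divided by its first coefficient differs from ω
by a bounded multiple of the number of repeated primes, which is O(1) on average. Moreover log log
N(m) is within 1 of T unless N(m)² ≤ x, which is rare. Neither change survives division by √T
(`RegularCount.tendsto_sum_hFreeBox_sub`), and Lévy's continuity theorem concludes. -/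

/-! ### Convergence in law from characteristic functions -/

open MeasureTheory ProbabilityTheory in
/-- The normal law on `Iic a` has mass `Phi a`. -/
theorem gaussianReal_Iic (a : ℝ) : (gaussianReal 0 1).real (Set.Iic a) = Phi a := by
  rw [Measure.real, gaussianReal_apply_eq_integral _ one_ne_zero, ENNReal.toReal_ofReal
    (integral_nonneg fun x => gaussianPDFReal_nonneg _ _ _), Phi, ← integral_const_mul]
  simp [gaussianPDFReal]

open MeasureTheory ProbabilityTheory in
/-- If the characteristic functions of the values of `Y` at uniformly random points of finite sets
converge to that of the normal law, then so do the distribution functions. -/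
theorem tendsto_card_filter_le_div {ι β : Type*} {l : Filter ι} [l.IsCountablyGenerated]
    (s : ι → Finset β) (hs : ∀ᶠ i in l, (s i).Nonempty) (Y : β → ℝ)
    (hY : ∀ t : ℝ, Tendsto (fun i => ((s i).card : ℂ)⁻¹ *
      ∑ m ∈ s i, Complex.exp (t * Y m * Complex.I)) l (𝓝 (Complex.exp (-t ^ 2 / 2))))
    (a : ℝ) :
    Tendsto (fun i => (((s i).filter fun m => Y m ≤ a).card : ℝ) / (s i).card) l
      (𝓝 (Phi a)) := by
  classical
  -- The continuity theorem is applied along sequences; countable generation of `l` permits the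
  -- reduction.
  refine tendsto_of_seq_tendsto fun u hu => ?_
  let ν : Finset β → Measure ℝ := fun F => ∑ m ∈ F, ((F.card : ENNReal)⁻¹) • Measure.dirac (Y m)
  have hν : ∀ F : Finset β, F.Nonempty → IsProbabilityMeasure (ν F) := by
    intro F hF
    constructor
    have h0 : (F.card : ENNReal) ≠ 0 := by simpa using hF.ne_empty
    simp [ν, ENNReal.mul_inv_cancel h0]
  -- The Dirac mass at 0 is a dummy value for the indices with empty sample, of which there are
  -- eventually none.
  let μ : ℕ → ProbabilityMeasure ℝ := fun n =>
    if h : (s (u n)).Nonempty then ⟨ν (s (u n)), hν _ h⟩ else ⟨Measure.dirac 0, inferInstance⟩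
  have hμ : ∀ᶠ n in atTop, (μ n : Measure ℝ) = ν (s (u n)) := by
    filter_upwards [hu.eventually hs] with n hn
    simp [μ, hn]
  have hint : ∀ (F : Finset β) (g : ℝ → ℂ), Continuous g →
      ∫ y, g y ∂(ν F) = (F.card : ℂ)⁻¹ * ∑ m ∈ F, g (Y m) := by
    intro F g hg
    rcases F.eq_empty_or_nonempty with rfl | hF
    · simp [ν]
    rw [integral_finsetSum_measure, Finset.mul_sum]
    · refine Finset.sum_congr rfl fun m _ => ?_
      rw [integral_smul_measure, integral_dirac]
      simp
    · intro m _
      refine Integrable.smul_measure ?_ (by simpa using hF.ne_empty)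
      exact integrable_dirac (by finiteness)
  let γ : ProbabilityMeasure ℝ := ⟨gaussianReal 0 1, inferInstance⟩
  have hγ : (γ : Measure ℝ) = gaussianReal 0 1 := rfl
  have hlim : Tendsto μ atTop (𝓝 γ) := by
    rw [ProbabilityMeasure.tendsto_iff_tendsto_charFun]
    intro t
    have h1 := (hY t).comp hu
    refine Tendsto.congr' ?_ (h1.trans_eq ?_)
    · filter_upwards [hμ] with n hn
      rw [hn, charFun_apply_real, hint _ _ (by fun_prop)]
      rfl
    · rw [hγ, charFun_gaussianReal]
      congr 2
      simp
      ring
  -- The frontier is a point and the normal law has no atoms, so the portmanteau theorem applies to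
  -- the half-line.
  have hfr : (γ : Measure ℝ) (frontier (Set.Iic a)) = 0 := by
    rw [hγ]
    have := nullSingletonClass_gaussianReal (μ := 0) (v := 1) one_ne_zero
    simp
  have h2 := ProbabilityMeasure.tendsto_measure_of_null_frontier_of_tendsto' hlim hfr
  have h3 := (ENNReal.tendsto_toReal (measure_ne_top _ _)).comp h2
  rw [← gaussianReal_Iic]
  refine Tendsto.congr' ?_ h3
  filter_upwards [hμ] with n hn
  simp only [Function.comp_apply, hn, ν, Measure.finsetSum_apply, Measure.smul_apply,
    Measure.dirac_apply' _ measurableSet_Iic, smul_eq_mul, ← Finset.mul_sum, ENNReal.toReal_mul,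
    Set.indicator_apply, Set.mem_Iic, Pi.one_apply]
  rw [Finset.sum_boole]
  simp [div_eq_inv_mul]

/-! ### Truncated expansions and elementary inequalities -/

open Finset in
/-- The truncation error in the expansion of `∏ (1 + w u_p)` by degree in `w`. -/
theorem norm_prod_one_add_sub_sum_powersetCard_le {β : Type*} (F : Finset β) (u : β → ℝ)
    (hu0 : ∀ p, 0 ≤ u p) (hu1 : ∀ p, u p ≤ 1) (w : ℂ) (hw : ‖1 + w‖ ≤ 1) (K : ℕ) :
    ‖∏ p ∈ F, (1 + w * u p) - ∑ j ∈ range K, w ^ j * ∑ d ∈ powersetCard j F, ∏ p ∈ d, (u p : ℂ)‖ ≤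
      ‖w‖ ^ K * ∑ d ∈ powersetCard K F, ∏ p ∈ d, u p := by
  classical
  have h1 : ∀ p, ‖1 + w * u p‖ ≤ 1 := by
    intro p
    -- Each factor is a convex combination of 1 and 1 + w, so it lies in the unit disc.
    have : 1 + w * u p = ((1 - u p : ℝ) : ℂ) + (u p : ℂ) * (1 + w) := by push_cast; ring
    rw [this]
    refine (norm_add_le _ _).trans ?_
    rw [norm_mul, Complex.norm_real, Complex.norm_real, Real.norm_of_nonneg (hu0 p),
      Real.norm_of_nonneg (sub_nonneg.2 (hu1 p))]
    nlinarith [hu0 p]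
  induction F using Finset.induction_on generalizing K with
  | empty =>
    rcases K with _ | K
    · simp
    · have h0 : ∀ k, powersetCard (k + 1) (∅ : Finset β) = ∅ := by simp [powersetCard_eq_empty]
      simp [Finset.sum_range_succ', h0]
  | insert q F hq ih =>
    rcases K with _ | K
    · simp only [range_zero, sum_empty, sub_zero, pow_zero, powersetCard_zero, sum_singleton,
        prod_empty, mul_one, norm_prod]
      exact Finset.prod_le_one (fun _ _ => norm_nonneg _) fun p _ => h1 p
    have key : ∀ {R : Type} [CommSemiring R] (v : β → R) (j : ℕ),
        ∑ d ∈ powersetCard (j + 1) (insert q F), ∏ p ∈ d, v p =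
        ∑ d ∈ powersetCard (j + 1) F, ∏ p ∈ d, v p +
          v q * ∑ d ∈ powersetCard j F, ∏ p ∈ d, v p := by
      intro R _ v j
      rw [powersetCard_succ_insert hq, sum_union, sum_image, mul_sum]
      · congr 1
        refine sum_congr rfl fun d hd => ?_
        rw [prod_insert fun h => hq ((mem_powersetCard.1 hd).1 h)]
      · intro d hd e he hde
        have hd' : q ∉ d := fun h => hq ((mem_powersetCard.1 hd).1 h)
        have he' : q ∉ e := fun h => hq ((mem_powersetCard.1 he).1 h)
        simpa [erase_insert hd', erase_insert he'] using congrArg (fun z => z.erase q) hde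
      · rw [disjoint_left]
        intro d hd hd'
        obtain ⟨e, -, rfl⟩ := mem_image.1 hd'
        exact hq ((mem_powersetCard.1 hd).1 (mem_insert_self _ _))
    -- The remainders satisfy R_{K+1}(F ∪ {q}) = R_{K+1}(F) + w u_q R_K(F). The claimed bound obeys
    -- the same recursion, so the induction loses nothing; the unit disc bound is used only at K =
    -- 0.
    have e1 : ∏ p ∈ insert q F, (1 + w * u p) - ∑ j ∈ range (K + 1), w ^ j *
          ∑ d ∈ powersetCard j (insert q F), ∏ p ∈ d, (u p : ℂ) =
        (∏ p ∈ F, (1 + w * u p) - ∑ j ∈ range (K + 1), w ^ j *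
          ∑ d ∈ powersetCard j F, ∏ p ∈ d, (u p : ℂ)) +
        w * u q * (∏ p ∈ F, (1 + w * u p) - ∑ j ∈ range K, w ^ j *
          ∑ d ∈ powersetCard j F, ∏ p ∈ d, (u p : ℂ)) := by
      rw [prod_insert hq, sum_range_succ', sum_range_succ' (n := K)]
      simp_rw [key (fun p => (u p : ℂ)), mul_add, sum_add_distrib, mul_sub, mul_sum]
      simp only [powersetCard_zero, pow_succ]
      ring_nf
    rw [e1, key u]
    refine (norm_add_le _ _).trans ?_
    rw [norm_mul, norm_mul, Complex.norm_real, Real.norm_of_nonneg (hu0 q)]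
    have i1 := ih (K + 1)
    have i2 := mul_le_mul_of_nonneg_left (ih K) (mul_nonneg (norm_nonneg w) (hu0 q))
    calc _ ≤ _ := add_le_add i1 i2
      _ = _ := by ring

open Finset in
/-- An exponentially weighted bound for an elementary symmetric sum. -/
theorem pow_mul_sum_powersetCard_le_exp {β : Type*} (F : Finset β) (u : β → ℝ)
    (hu0 : ∀ p, 0 ≤ u p) {r : ℝ} (hr : 0 ≤ r) (K : ℕ) :
    r ^ K * ∑ d ∈ powersetCard K F, ∏ p ∈ d, u p ≤ Real.exp (r * ∑ p ∈ F, u p) := by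
  classical
  calc r ^ K * ∑ d ∈ powersetCard K F, ∏ p ∈ d, u p
      = ∑ d ∈ powersetCard K F, ∏ p ∈ d, (r * u p) := by
        rw [mul_sum]
        refine sum_congr rfl fun d hd => ?_
        rw [prod_mul_distrib, prod_const, (mem_powersetCard.1 hd).2]
    _ ≤ ∑ d ∈ F.powerset, ∏ p ∈ d, (r * u p) :=
        sum_le_sum_of_subset_of_nonneg (fun d hd => mem_powerset.2 (mem_powersetCard.1 hd).1)
          fun d _ _ => prod_nonneg fun p _ => mul_nonneg hr (hu0 p)
    _ = ∏ p ∈ F, (1 + r * u p) := (prod_one_add _).symm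
    _ ≤ Real.exp (∑ p ∈ F, r * u p) :=
        Real.prod_one_add_le_exp_sum _ fun p => mul_nonneg hr (hu0 p)
    _ = _ := by rw [mul_sum]

/-- Products of numbers in the unit disc differ by at most the sum of the differences. -/
theorem norm_prod_sub_prod_le {β : Type*} (F : Finset β) (f g : β → ℂ)
    (hf : ∀ p ∈ F, ‖f p‖ ≤ 1) (hg : ∀ p ∈ F, ‖g p‖ ≤ 1) :
    ‖∏ p ∈ F, f p - ∏ p ∈ F, g p‖ ≤ ∑ p ∈ F, ‖f p - g p‖ := by
  classical
  induction F using Finset.induction_on with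
  | empty => simp
  | insert q F hq ih =>
    rw [Finset.prod_insert hq, Finset.prod_insert hq, Finset.sum_insert hq]
    have e : f q * ∏ p ∈ F, f p - g q * ∏ p ∈ F, g p =
        (f q - g q) * ∏ p ∈ F, f p + g q * (∏ p ∈ F, f p - ∏ p ∈ F, g p) := by ring
    rw [e]
    refine (norm_add_le _ _).trans ?_
    rw [norm_mul, norm_mul]
    have h1 : ‖∏ p ∈ F, f p‖ ≤ 1 := by
      rw [norm_prod]
      exact Finset.prod_le_one (fun _ _ => norm_nonneg _)
        fun p hp => hf p (Finset.mem_insert_of_mem hp)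
    have h2 := ih (fun p hp => hf p (Finset.mem_insert_of_mem hp))
      fun p hp => hg p (Finset.mem_insert_of_mem hp)
    have h3 := hg q (Finset.mem_insert_self _ _)
    nlinarith [norm_nonneg (f q - g q), norm_nonneg (∏ p ∈ F, f p - ∏ p ∈ F, g p),
      norm_nonneg (g q)]

/-- A count of the subsets with fewer than `K` elements. -/
theorem sum_range_choose_le (n K : ℕ) :
    ∑ j ∈ Finset.range K, (n.choose j : ℝ) ≤ ((n : ℝ) + 1) ^ K := by
  induction K with
  | zero => simp
  | succ K ih =>
    rw [Finset.sum_range_succ, pow_succ]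
    have h1 : (n.choose K : ℝ) ≤ (n : ℝ) ^ K := by exact_mod_cast Nat.choose_le_pow n K
    have h2 : (n : ℝ) ^ K ≤ ((n : ℝ) + 1) ^ K := by gcongr; linarith
    rcases n with _ | n
    · rcases K with _ | K
      · simp
      · simp only [Nat.choose_zero_succ] at *
        simpa using ih
    · have : (1 : ℝ) ≤ ((n + 1 : ℕ) : ℝ) := by push_cast; linarith [(Nat.cast_nonneg n : (0:ℝ) ≤ n)]
      nlinarith [pow_nonneg (by positivity : (0 : ℝ) ≤ ((n + 1 : ℕ) : ℝ) + 1) K]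

/-- A chord is shorter than its arc, after factoring out the unimodular `exp (b * I)`. -/
theorem norm_exp_mul_I_sub_exp_mul_I_le (a b : ℝ) :
    ‖Complex.exp (a * Complex.I) - Complex.exp (b * Complex.I)‖ ≤ |a - b| := by
  have e : Complex.exp (a * Complex.I) - Complex.exp (b * Complex.I) =
      Complex.exp (b * Complex.I) * (Complex.exp (Complex.I * ((a - b : ℝ) : ℂ)) - 1) := by
    rw [mul_sub, ← Complex.exp_add, mul_one]
    congr 2
    push_cast
    ring
  rw [e, norm_mul, Complex.norm_exp_ofReal_mul_I, one_mul]
  exact Real.norm_exp_I_mul_ofReal_sub_one_le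

/-- Second order is what the normal limit needs: with s of order 1/√T, the cubic error times a mean
of order T still tends to 0. -/
theorem norm_exp_mul_I_sub_one_sub_le {s : ℝ} (hs : |s| ≤ 1) :
    ‖Complex.exp (s * Complex.I) - 1 - s * Complex.I + s ^ 2 / 2‖ ≤ |s| ^ 3 := by
  have h := Complex.exp_bound (x := s * Complex.I) (by simpa using hs) (n := 3) (by norm_num)
  simp only [Finset.sum_range_succ, Finset.sum_range_zero] at h
  norm_num [Nat.factorial, mul_pow] at h
  have e : Complex.exp (s * Complex.I) - 1 - s * Complex.I + s ^ 2 / 2 =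
    Complex.exp (↑s * Complex.I) - (1 + ↑s * Complex.I + -↑s ^ 2 / 2) := by ring
  rw [e]
  refine h.trans ?_
  nlinarith [pow_nonneg (abs_nonneg s) 3]

/-! ### The counting function and uniform bounds for it -/

variable {P : Type*} {N : P → ℕ} {X : Set ℚ}

theorem norm_zero (N : P → ℕ) : norm N 0 = 1 := by simp [norm]

theorem norm_add (N : P → ℕ) (m n : P →₀ ℕ) : norm N (m + n) = norm N m * norm N n :=
  Finsupp.prod_add_index' (fun _ => pow_zero _) fun _ _ _ => pow_add _ _ _

theorem norm_pos (hN : ∀ p, 1 < N p) (m : P →₀ ℕ) : 0 < norm N m :=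
  Finset.prod_pos fun p _ => pow_pos (zero_lt_one.trans (hN p)) _

open Classical in
/-- The elements of norm at most `x`, as a finite set. -/
noncomputable def box (N : P → ℕ) (x : ℚ) : Finset (P →₀ ℕ) :=
  if h : (upTo N Set.univ x).Finite then h.toFinset else ∅

/-- The default value ∅ of `box` agrees with the convention that `ncard` vanishes on infinite sets.
-/
theorem card_box (N : P → ℕ) (x : ℚ) : (box N x).card = (upTo N Set.univ x).ncard := by
  unfold box
  split_ifs with h
  · rw [Set.ncard_eq_toFinset_card _ h]
  · rw [Set.Infinite.ncard h, Finset.card_empty]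

theorem IsRange.one_mem (hX : IsRange N X) : (1 : ℚ) ∈ X := by
  simpa [norm_zero] using hX.norm_mem 0

theorem IsRange.mul_mem (hX : IsRange N X) {x y : ℚ} (hx : x ∈ X) (hy : y ∈ X) : x * y ∈ X := by
  rcases eq_or_ne y 0 with rfl | h
  · simpa using hy
  · have := hX.div_mem x hx (1 / y) (hX.div_mem 1 hX.one_mem y hy h) (by positivity)
    simpa using this

theorem IsRange.pow_mem (hX : IsRange N X) {x : ℚ} (hx : x ∈ X) (n : ℕ) : x ^ n ∈ X := by
  induction n with
  | zero => simpa using hX.one_mem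
  | succ n ih => rw [pow_succ]; exact hX.mul_mem ih hx

/-- Uniform consequences of the counting condition on an unbounded range `X`. -/
structure RegularCount (N : P → ℕ) (X : Set ℚ) (κ θ C : ℝ) : Prop where
  one_lt : ∀ p, 1 < N p
  range : IsRange N X
  dens_pos : 0 < κ
  exp_nonneg : 0 ≤ θ
  exp_lt_one : θ < 1
  const_pos : 0 < C
  finite : ∀ x : ℚ, (upTo N Set.univ x).Finite
  -- The error is measured at a majorant x ≥ 1 of u, because u will be a quotient x / N(e), possibly
  -- below 1 where its own power does not control the error.
  approx : ∀ u ∈ X, 0 < u → ∀ x : ℝ, 1 ≤ x → (u : ℝ) ≤ x →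
    |((box N u).card : ℝ) - κ * u| ≤ C * x ^ θ
  card_le : ∀ u ∈ X, 0 < u → ((box N u).card : ℝ) ≤ C * u
  le_card : ∃ c : ℝ, 0 < c ∧ ∀ u ∈ X, 1 ≤ u → c * u ≤ ((box N u).card : ℝ)
  exists_one_lt : ∃ q ∈ X, 1 < q

theorem mem_box_of_finite {x : ℚ} (h : (upTo N Set.univ x).Finite) {m : P →₀ ℕ} :
    m ∈ box N x ↔ (norm N m : ℚ) ≤ x := by
  rw [box, dif_pos h]
  simp [upTo]

/-- For large x in X the main term beats the error, so the count is positive and the set is finite;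
by monotonicity all these sets are finite. Below a threshold the counts are bounded and go into the
constant. -/
theorem exists_regularCount (hN : ∀ p, 1 < N p) (hX : IsRange N X) (hc : CountingCondition N X)
    [NeBot (atTopIn X)] : ∃ κ θ C, RegularCount N X κ θ C := by
  obtain ⟨κ, θ, hκ, hθ0, hθ1, hO⟩ := hc
  obtain ⟨C₀, hC₀, hO⟩ := hO.exists_pos
  have hO := hO.bound
  simp_rw [← card_box] at hO
  have hlarge : ∀ y : ℚ, ∃ x ∈ X, y ≤ x := by
    intro y
    have h1 : ∀ᶠ x in atTopIn X, y ≤ x ∧ x ∈ X :=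
      eventually_inf_principal.2 ((eventually_ge_atTop y).mono fun x hx hxX => ⟨hx, hxX⟩)
    obtain ⟨x, hx⟩ := h1.exists
    exact ⟨x, hx.2, hx.1⟩
  have hsmall : ∀ᶠ x : ℚ in atTop, C₀ * (x : ℝ) ^ θ ≤ κ / 2 * x := by
    have h1 : Tendsto (fun x : ℝ => x ^ (1 - θ)) atTop atTop := tendsto_rpow_atTop (by linarith)
    have h2 := (h1.comp (tendsto_ratCast_atTop_iff.2 tendsto_id :
      Tendsto (fun x : ℚ => (x : ℝ)) atTop atTop)).eventually_ge_atTop (2 * C₀ / κ)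
    filter_upwards [h2, eventually_gt_atTop 0] with x hx hx0
    have hx0' : (0 : ℝ) < x := by exact_mod_cast hx0
    simp only [Function.comp_apply] at hx
    have e : (x : ℝ) = x ^ (1 - θ) * x ^ θ := by
      rw [← Real.rpow_add hx0']; simp
    rw [div_le_iff₀ hκ] at hx
    have h3 : (0 : ℝ) < x ^ θ := Real.rpow_pos_of_pos hx0' θ
    calc C₀ * (x : ℝ) ^ θ = (2 * C₀) / 2 * x ^ θ := by ring
      _ ≤ (x ^ (1 - θ) * κ) / 2 * x ^ θ := by gcongr
      _ = κ / 2 * (x ^ (1 - θ) * x ^ θ) := by ring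
      _ = _ := by rw [← e]
  have hev := (eventually_inf_principal.1 hO).and (hsmall.and (eventually_ge_atTop 1))
  obtain ⟨x₀, hx₀⟩ := eventually_atTop.1 hev
  have hx₀1 : 1 ≤ x₀ := (hx₀ x₀ le_rfl).2.2
  have hx₀1' : (1 : ℝ) ≤ x₀ := by exact_mod_cast hx₀1
  have happ : ∀ u ∈ X, x₀ ≤ u → |((box N u).card : ℝ) - κ * u| ≤ C₀ * (u : ℝ) ^ θ := by
    intro u hu hxu
    have := (hx₀ u hxu).1 hu
    have hu0 : (0 : ℝ) ≤ u := by exact_mod_cast (zero_le_one.trans (hx₀1.trans hxu))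
    rwa [Real.norm_eq_abs, Real.norm_of_nonneg (Real.rpow_nonneg hu0 _)] at this
  have hhalf : ∀ u ∈ X, x₀ ≤ u → κ / 2 * u ≤ ((box N u).card : ℝ) := by
    intro u hu hxu
    have h1 := (abs_le.1 (happ u hu hxu)).1
    have h2 := (hx₀ u hxu).2.1
    linarith
  have hfin : ∀ x : ℚ, (upTo N Set.univ x).Finite := by
    intro x
    obtain ⟨y, hyX, hy⟩ := hlarge (max x x₀)
    have hy0 : (0 : ℝ) < y := by
      exact_mod_cast zero_lt_one.trans_le (hx₀1.trans ((le_max_right _ _).trans hy))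
    have h1 := hhalf y hyX ((le_max_right _ _).trans hy)
    have h2 : (0 : ℝ) < ((upTo N Set.univ y).ncard : ℝ) := by
      rw [← card_box]
      exact lt_of_lt_of_le (by positivity) h1
    have h3 : (upTo N Set.univ y).Finite := Set.finite_of_ncard_pos (by exact_mod_cast h2)
    exact h3.subset fun m hm => ⟨hm.1, hm.2.trans ((le_max_left _ _).trans hy)⟩
  have hmono : ∀ {u v : ℚ}, u ≤ v → (box N u).card ≤ (box N v).card := by
    intro u v huv
    refine Finset.card_le_card fun m hm => ?_
    rw [mem_box_of_finite (hfin _)] at hm ⊢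
    exact hm.trans huv
  set C : ℝ := C₀ + κ * x₀ + (box N x₀).card with hC
  have hCpos : 0 < C := by positivity
  have happ' : ∀ u ∈ X, 0 < u → ∀ x : ℝ, 1 ≤ x → (u : ℝ) ≤ x →
      |((box N u).card : ℝ) - κ * u| ≤ C * x ^ θ := by
    intro u hu hu0 x hx hux
    have hu0' : (0 : ℝ) < u := by exact_mod_cast hu0
    have hxθ : 1 ≤ x ^ θ := Real.one_le_rpow hx hθ0
    have hnn : (0 : ℝ) ≤ (box N x₀).card := Nat.cast_nonneg _
    rcases le_or_gt x₀ u with h | h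
    · refine (happ u hu h).trans ?_
      have h1 : C₀ ≤ C := by rw [hC]; nlinarith
      gcongr
    · have h1 : ((box N u).card : ℝ) ≤ (box N x₀).card := by exact_mod_cast hmono h.le
      have h2 : κ * u ≤ κ * x₀ := by gcongr
      have h3 : 0 ≤ κ * u := by positivity
      have h4 : (0 : ℝ) ≤ (box N u).card := Nat.cast_nonneg _
      have h5 : |((box N u).card : ℝ) - κ * u| ≤ C := by
        rw [abs_le]
        constructor <;> linarith
      nlinarith
  -- The constant `κ + C` serves both bounds: for u ≥ 1 the count is at most κu + Cu^θ ≤ (κ + C)u.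
  refine ⟨κ, θ, κ + C, hN, hX, hκ, hθ0, hθ1, by positivity, hfin, ?_, ?_, ?_, ?_⟩
  · intro u hu hu0 x hx hux
    refine (happ' u hu hu0 x hx hux).trans ?_
    have hxθ : 0 ≤ x ^ θ := Real.rpow_nonneg (by linarith) _
    nlinarith
  · intro u hu hu0
    have hu0' : (0 : ℝ) < u := by exact_mod_cast hu0
    rcases le_or_gt 1 u with h | h
    · have hu1 : (1 : ℝ) ≤ u := by exact_mod_cast h
      have h1 := (abs_le.1 (happ' u hu hu0 u hu1 le_rfl)).2
      have h2 : (u : ℝ) ^ θ ≤ u := by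
        simpa using Real.rpow_le_rpow_of_exponent_le hu1 hθ1.le
      nlinarith
    · have : box N u = ∅ := by
        rw [Finset.eq_empty_iff_forall_notMem]
        intro m hm
        rw [mem_box_of_finite (hfin _)] at hm
        have : (1 : ℚ) ≤ norm N m := by exact_mod_cast norm_pos hN m
        linarith
      rw [this]
      simp only [Finset.card_empty, Nat.cast_zero]
      positivity
  -- Above x₀ half of the main term survives; below x₀ the zero element alone gives a count of at
  -- least 1 ≥ u / x₀.
  · refine ⟨min (κ / 2) (1 / x₀), by positivity, ?_⟩
    intro u hu hu1
    have hu1' : (1 : ℝ) ≤ u := by exact_mod_cast hu1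
    rcases le_or_gt x₀ u with h | h
    · exact (mul_le_mul_of_nonneg_right (min_le_left _ _) (by linarith)).trans (hhalf u hu h)
    · have h1 : (1 : ℝ) ≤ (box N u).card := by
        have : 0 < (box N u).card := by
          refine Finset.card_pos.2 ⟨0, ?_⟩
          rw [mem_box_of_finite (hfin _), norm_zero]
          exact_mod_cast hu1
        exact_mod_cast this
      refine le_trans ?_ h1
      refine (mul_le_mul_of_nonneg_right (min_le_right _ _) (by linarith)).trans ?_
      rw [one_div, inv_mul_le_iff₀ (by linarith)]
      have : (u : ℝ) ≤ x₀ := by exact_mod_cast h.le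
      linarith
  · obtain ⟨q, hq, hq2⟩ := hlarge 2
    exact ⟨q, hq, by linarith⟩

namespace RegularCount

variable {κ θ C : ℝ}

theorem mem_box (H : RegularCount N X κ θ C) {x : ℚ} {m : P →₀ ℕ} :
    m ∈ box N x ↔ (norm N m : ℚ) ≤ x :=
  mem_box_of_finite (H.finite x)

theorem norm_pos (H : RegularCount N X κ θ C) (m : P →₀ ℕ) : 0 < norm N m :=
  AbelianMonoid.norm_pos H.one_lt m

theorem div_norm_mem (H : RegularCount N X κ θ C) {x : ℚ} (hx : x ∈ X) (m : P →₀ ℕ) :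
    x / norm N m ∈ X :=
  H.range.div_mem x hx _ (H.range.norm_mem m) (by exact_mod_cast (H.norm_pos m).ne')

open Classical in
/-- Sums over the multiples of `e` of bounded norm. -/
theorem sum_box_filter_le {R : Type*} [AddCommMonoid R] (H : RegularCount N X κ θ C) (x : ℚ)
    (e : P →₀ ℕ) (f : (P →₀ ℕ) → R) :
    ∑ m ∈ (box N x).filter (fun m => e ≤ m), f m = ∑ m ∈ box N (x / norm N e), f (m + e) := by
  have he : (0 : ℚ) < norm N e := by exact_mod_cast H.norm_pos e
  symm
  refine Finset.sum_bij (fun m _ => m + e) ?_ ?_ ?_ ?_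
  · intro m hm
    rw [H.mem_box, le_div_iff₀ he] at hm
    rw [Finset.mem_filter, H.mem_box, norm_add]
    exact ⟨by exact_mod_cast hm, le_add_self⟩
  · intro a _ b _ hab
    exact add_right_cancel hab
  · intro b hb
    rw [Finset.mem_filter, H.mem_box] at hb
    obtain ⟨m, rfl⟩ := exists_add_of_le hb.2
    refine ⟨m, ?_, add_comm _ _⟩
    rw [H.mem_box, le_div_iff₀ he]
    have := hb.1
    rw [norm_add, mul_comm] at this
    exact_mod_cast this
  · intro m _
    rfl

open Classical in
theorem card_box_filter_le (H : RegularCount N X κ θ C) (x : ℚ) (e : P →₀ ℕ) :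
    ((box N x).filter (fun m => e ≤ m)).card = (box N (x / norm N e)).card := by
  have := H.sum_box_filter_le x e (fun _ => (1 : ℕ))
  simpa using this

theorem card_box_div_le (H : RegularCount N X κ θ C) {x : ℚ} (hx : x ∈ X) (hx0 : 0 < x)
    (e : P →₀ ℕ) : ((box N (x / norm N e)).card : ℝ) ≤ C * (x / norm N e) := by
  have he : (0 : ℚ) < norm N e := by exact_mod_cast H.norm_pos e
  have := H.card_le _ (H.div_norm_mem hx e) (by positivity)
  exact_mod_cast this

end RegularCount

/-- The element with multiplicity `k` at the points of `d` and `0` elsewhere. -/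
noncomputable def constOn (d : Finset P) (k : ℕ) : P →₀ ℕ :=
  Finsupp.indicator d fun _ _ => k

open Classical in
theorem constOn_apply (d : Finset P) (k : ℕ) (p : P) :
    constOn d k p = if p ∈ d then k else 0 := by
  simp [constOn, Finsupp.indicator_apply]

theorem norm_constOn (N : P → ℕ) (d : Finset P) (k : ℕ) :
    norm N (constOn d k) = ∏ p ∈ d, N p ^ k := by
  classical
  rw [norm, Finsupp.prod_of_support_subset (s := d)]
  · exact Finset.prod_congr rfl fun p hp => by simp [constOn_apply, hp]
  · exact Finsupp.support_indicator_subset _ _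
  · simp

theorem constOn_le_iff (d : Finset P) (k : ℕ) (m : P →₀ ℕ) :
    constOn d k ≤ m ↔ ∀ p ∈ d, k ≤ m p := by
  classical
  rw [Finsupp.le_def]
  refine ⟨fun h p hp => by simpa [constOn_apply, hp] using h p, fun h p => ?_⟩
  rw [constOn_apply]
  split_ifs with hp
  · exact h p hp
  · exact Nat.zero_le _

/-! ### The zeta function and the prime zeta function near 1 -/

variable {κ θ C : ℝ}

theorem sum_range_pow_le_inv {ρ : ℝ} (h0 : 0 ≤ ρ) (h1 : ρ < 1) (J : ℕ) :
    ∑ j ∈ Finset.range J, ρ ^ j ≤ (1 - ρ)⁻¹ := by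
  rw [← tsum_geometric_of_lt_one h0 h1]
  exact (summable_geometric_of_lt_one h0 h1).sum_le_tsum _ fun _ _ => pow_nonneg h0 _

/-- Upper bound for the partial sums of the zeta function near `s = 1`. -/
theorem RegularCount.exists_sum_rpow_le (H : RegularCount N X κ θ C) :
    ∃ c : ℝ, 0 < c ∧ ∀ δ : ℝ, 0 < δ → δ ≤ 1 → ∀ F : Finset (P →₀ ℕ),
      ∑ m ∈ F, (norm N m : ℝ) ^ (-(1 + δ)) ≤ c / δ := by
  classical
  obtain ⟨q, hqX, hq⟩ := H.exists_one_lt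
  have hq' : (1 : ℝ) < q := by exact_mod_cast hq
  have hq0 : (0 : ℝ) < q := by linarith
  have hlog : 0 < Real.log q := Real.log_pos hq'
  have hC := H.const_pos
  refine ⟨(q : ℝ) ^ 2 * C * (1 + 1 / Real.log q), by positivity, ?_⟩
  intro δ hδ hδ1 F
  set r : ℝ := (q : ℝ) ^ (-(1 + δ)) with hr
  have hr0 : 0 < r := Real.rpow_pos_of_pos hq0 _
  -- Counts are controlled only on X, so norms are sorted by a geometric grid of powers of q ∈ X:
  -- the index j satisfies q^(j-1) ≤ n < q^j.
  have hex : ∀ n : ℕ, ∃ j : ℕ, (0 < n → (n : ℚ) ≤ q ^ j ∧ (n : ℝ) ^ (-(1 + δ)) ≤ r⁻¹ * r ^ j) := by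
    intro n
    rcases Nat.eq_zero_or_pos n with rfl | hn
    · exact ⟨0, fun h => absurd h (lt_irrefl _)⟩
    obtain ⟨k, hk1, hk2⟩ := exists_nat_pow_near (by exact_mod_cast hn : (1 : ℚ) ≤ n) hq
    refine ⟨k + 1, fun _ => ⟨hk2.le, ?_⟩⟩
    have hk1' : (q : ℝ) ^ k ≤ n := by exact_mod_cast hk1
    rw [pow_succ, mul_comm, mul_assoc, mul_inv_cancel₀ hr0.ne', mul_one, hr, ← Real.rpow_natCast,
      ← Real.rpow_mul hq0.le, mul_comm, Real.rpow_mul hq0.le, Real.rpow_natCast]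
    exact Real.rpow_le_rpow_of_nonpos (by positivity) hk1' (by linarith)
  choose j hj using hex
  set J := F.sup (fun m => j (norm N m)) + 1 with hJ
  have hρ : r * q = (q : ℝ) ^ (-δ) := by
    rw [hr]
    nth_rewrite 2 [← Real.rpow_one (q : ℝ)]
    rw [← Real.rpow_add hq0]
    congr 1
    ring
  have hqδ : 1 + δ * Real.log q ≤ (q : ℝ) ^ δ := by
    rw [Real.rpow_def_of_pos hq0, mul_comm, add_comm]
    exact Real.add_one_le_exp _
  have hδl : 0 < δ * Real.log q := by positivity
  have hρ0 : 0 < (q : ℝ) ^ (-δ) := Real.rpow_pos_of_pos hq0 _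
  have hρ1 : (q : ℝ) ^ (-δ) < 1 := Real.rpow_lt_one_of_one_lt_of_neg hq' (by linarith)
  -- Level i of the grid contributes at most C q^i r^i = C q^(-δi), so the total is governed by this
  -- geometric series, of size 1/(δ log q).
  have hρinv : (1 - (q : ℝ) ^ (-δ))⁻¹ ≤ (1 + 1 / Real.log q) / δ := by
    rw [inv_le_comm₀ (by linarith) (by positivity)]
    rw [Real.rpow_neg hq0.le]
    have h1 : ((q : ℝ) ^ δ)⁻¹ ≤ (1 + δ * Real.log q)⁻¹ := inv_anti₀ (by linarith) hqδ
    have h2 : ((1 + 1 / Real.log q) / δ)⁻¹ ≤ 1 - (1 + δ * Real.log q)⁻¹ := by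
      have e1 : ((1 + 1 / Real.log q) / δ)⁻¹ = δ * Real.log q / (1 + Real.log q) := by
        field_simp
        ring
      have e2 : 1 - (1 + δ * Real.log q)⁻¹ = δ * Real.log q / (1 + δ * Real.log q) := by
        field_simp
        ring
      rw [e1, e2]
      apply div_le_div_of_nonneg_left hδl.le (by positivity)
      nlinarith
    linarith
  have hrinv : r⁻¹ ≤ (q : ℝ) ^ 2 := by
    rw [hr, Real.rpow_neg hq0.le, inv_inv, ← Real.rpow_natCast]
    exact Real.rpow_le_rpow_of_exponent_le hq'.le (by push_cast; linarith)
  calc ∑ m ∈ F, (norm N m : ℝ) ^ (-(1 + δ))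
      ≤ ∑ m ∈ F, r⁻¹ * ∑ i ∈ Finset.range J, if (norm N m : ℚ) ≤ q ^ i then r ^ i else 0 := by
        refine Finset.sum_le_sum fun m hm => ?_
        obtain ⟨h1, h2⟩ := hj (norm N m) (H.norm_pos m)
        refine h2.trans (mul_le_mul_of_nonneg_left ?_ (inv_nonneg.2 hr0.le))
        have hmem : j (norm N m) ∈ Finset.range J := by
          rw [Finset.mem_range, hJ, Nat.lt_succ_iff]
          exact Finset.le_sup (f := fun m => j (norm N m)) hm
        refine le_trans ?_ (Finset.single_le_sum (fun i _ => ?_) hmem)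
        · rw [if_pos h1]
        · split_ifs <;> positivity
    _ = r⁻¹ * ∑ i ∈ Finset.range J, (F.filter fun m => (norm N m : ℚ) ≤ q ^ i).card * r ^ i := by
        rw [← Finset.mul_sum, Finset.sum_comm]
        congr 1
        refine Finset.sum_congr rfl fun i _ => ?_
        rw [← Finset.sum_filter, Finset.sum_const, nsmul_eq_mul]
    _ ≤ r⁻¹ * ∑ i ∈ Finset.range J, C * ((q : ℝ) ^ (-δ)) ^ i := by
        refine mul_le_mul_of_nonneg_left (Finset.sum_le_sum fun i _ => ?_) (inv_nonneg.2 hr0.le)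
        have h1 : ((F.filter fun m => (norm N m : ℚ) ≤ q ^ i).card : ℝ) ≤ (box N (q ^ i)).card := by
          have : (F.filter fun m => (norm N m : ℚ) ≤ q ^ i) ⊆ box N (q ^ i) := fun m hm =>
            H.mem_box.2 (Finset.mem_filter.1 hm).2
          exact_mod_cast Finset.card_le_card this
        have h2 := H.card_le _ (H.range.pow_mem hqX i) (by positivity)
        rw [← hρ, mul_pow]
        push_cast at h2
        calc _ ≤ C * (q : ℝ) ^ i * r ^ i := by gcongr; exact h1.trans h2
          _ = _ := by ring
    _ ≤ r⁻¹ * (C * (1 - (q : ℝ) ^ (-δ))⁻¹) := by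
        rw [← Finset.mul_sum]
        gcongr
        exact sum_range_pow_le_inv hρ0.le hρ1 J
    _ ≤ (q : ℝ) ^ 2 * (C * ((1 + 1 / Real.log q) / δ)) := by gcongr
    _ = _ := by ring

theorem RegularCount.summable_rpow (H : RegularCount N X κ θ C) {δ : ℝ} (h0 : 0 < δ)
    (h1 : δ ≤ 1) : Summable fun m : P →₀ ℕ => (norm N m : ℝ) ^ (-(1 + δ)) := by
  obtain ⟨c, _, hc⟩ := H.exists_sum_rpow_le
  exact summable_of_sum_le (fun m => Real.rpow_nonneg (Nat.cast_nonneg _) _) (hc δ h0 h1)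

/-- Lower bound for the zeta function near `s = 1`. -/
theorem RegularCount.exists_le_tsum_rpow (H : RegularCount N X κ θ C) :
    ∃ c : ℝ, 0 < c ∧ ∀ δ : ℝ, 0 < δ → δ ≤ 1 →
      c / δ ≤ ∑' m : P →₀ ℕ, (norm N m : ℝ) ^ (-(1 + δ)) := by
  classical
  obtain ⟨q, hqX, hq⟩ := H.exists_one_lt
  obtain ⟨c, hc0, hc⟩ := H.le_card
  have hq' : (1 : ℝ) < q := by exact_mod_cast hq
  have hq0 : (0 : ℝ) < q := by linarith
  have hlog : 0 < Real.log q := Real.log_pos hq'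
  have hqi : 0 < 1 - (q : ℝ)⁻¹ := sub_pos.2 (inv_lt_one_of_one_lt₀ hq')
  refine ⟨(1 - (q : ℝ)⁻¹) * c / Real.log q, by positivity, ?_⟩
  intro δ hδ hδ1
  set r : ℝ := (q : ℝ) ^ (-(1 + δ)) with hr
  have hr0 : 0 < r := Real.rpow_pos_of_pos hq0 _
  have hrq : r ≤ (q : ℝ)⁻¹ := by
    rw [← Real.rpow_neg_one, hr]
    exact Real.rpow_le_rpow_of_exponent_le hq'.le (by linarith)
  have hr1 : r < 1 := by linarith
  have hρ : r * q = (q : ℝ) ^ (-δ) := by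
    rw [hr]
    nth_rewrite 2 [← Real.rpow_one (q : ℝ)]
    rw [← Real.rpow_add hq0]
    congr 1
    ring
  have hρ0 : 0 < (q : ℝ) ^ (-δ) := Real.rpow_pos_of_pos hq0 _
  have hρ1 : (q : ℝ) ^ (-δ) < 1 := Real.rpow_lt_one_of_one_lt_of_neg hq' (by linarith)
  -- Abel summation on the grid: if k is the least index with n ≤ q^k, then r^k is (1 - r) times the
  -- sum of r^i over i ≥ k, and r^k ≤ n^(-(1+δ)).
  have hterm : ∀ (n J : ℕ), 0 < n →
      (1 - r) * ∑ i ∈ Finset.range J, (if (n : ℚ) ≤ q ^ i then r ^ i else 0) ≤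
        (n : ℝ) ^ (-(1 + δ)) := by
    intro n J hn
    have hexi : ∃ i : ℕ, (n : ℚ) ≤ q ^ i := (pow_unbounded_of_one_lt _ hq).imp fun _ h => h.le
    set k := Nat.find hexi with hk
    have hkn : (n : ℝ) ≤ (q : ℝ) ^ k := by exact_mod_cast Nat.find_spec hexi
    have h1 : r ^ k ≤ (n : ℝ) ^ (-(1 + δ)) := by
      rw [hr, ← Real.rpow_natCast, ← Real.rpow_mul hq0.le, mul_comm, Real.rpow_mul hq0.le,
        Real.rpow_natCast]
      exact Real.rpow_le_rpow_of_nonpos (by exact_mod_cast hn) hkn (by linarith)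
    have h2 : ∑ i ∈ Finset.range J, (if (n : ℚ) ≤ q ^ i then r ^ i else 0) ≤
        ∑ i ∈ Finset.range J, r ^ k * r ^ i := by
      calc _ ≤ ∑ i ∈ Finset.range (k + J), (if (n : ℚ) ≤ q ^ i then r ^ i else 0) := by
            refine Finset.sum_le_sum_of_subset_of_nonneg
              (Finset.range_subset_range.2 (Nat.le_add_left _ _)) fun i _ _ => ?_
            split_ifs <;> positivity
        _ = ∑ i ∈ Finset.range J, (if (n : ℚ) ≤ q ^ (k + i) then r ^ (k + i) else 0) := by
            rw [Finset.sum_range_add, Finset.sum_eq_zero, zero_add]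
            intro i hi
            rw [if_neg]
            exact Nat.find_min hexi (Finset.mem_range.1 hi)
        _ ≤ _ := by
            refine Finset.sum_le_sum fun i _ => ?_
            rw [← pow_add]
            split_ifs
            · exact le_rfl
            · positivity
    calc _ ≤ (1 - r) * (r ^ k * (1 - r)⁻¹) := by
          refine mul_le_mul_of_nonneg_left (h2.trans ?_) (by linarith)
          rw [← Finset.mul_sum]
          gcongr
          exact sum_range_pow_le_inv hr0.le hr1 J
      _ = r ^ k := by
          rw [mul_comm (r ^ k), ← mul_assoc, mul_inv_cancel₀ (by linarith), one_mul]
      _ ≤ _ := h1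
  have hJ : ∀ J : ℕ, (1 - (q : ℝ)⁻¹) * (c * ∑ i ∈ Finset.range J, ((q : ℝ) ^ (-δ)) ^ i) ≤
      ∑' m : P →₀ ℕ, (norm N m : ℝ) ^ (-(1 + δ)) := by
    intro J
    calc _ ≤ (1 - r) * ∑ i ∈ Finset.range J, ((box N (q ^ i)).card : ℝ) * r ^ i := by
          rw [Finset.mul_sum]
          refine mul_le_mul (by linarith) (Finset.sum_le_sum fun i _ => ?_)
            (Finset.sum_nonneg fun i _ => by positivity) (by linarith)
          rw [← hρ, mul_pow]
          have h2 := hc _ (H.range.pow_mem hqX i) (one_le_pow₀ hq.le)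
          push_cast at h2
          calc c * (r ^ i * (q : ℝ) ^ i) = c * (q : ℝ) ^ i * r ^ i := by ring
            _ ≤ _ := by gcongr
      _ = ∑ m ∈ box N (q ^ J), (1 - r) * ∑ i ∈ Finset.range J,
            (if (norm N m : ℚ) ≤ q ^ i then r ^ i else 0) := by
          rw [← Finset.mul_sum, Finset.sum_comm]
          congr 1
          refine Finset.sum_congr rfl fun i hi => ?_
          rw [← Finset.sum_filter, Finset.sum_const, nsmul_eq_mul]
          congr 3
          ext m
          rw [Finset.mem_filter, H.mem_box, H.mem_box]
          refine ⟨fun h => ⟨h.trans ?_, h⟩, fun h => h.2⟩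
          exact pow_le_pow_right₀ hq.le (Finset.mem_range.1 hi).le
      _ ≤ ∑ m ∈ box N (q ^ J), (norm N m : ℝ) ^ (-(1 + δ)) :=
          Finset.sum_le_sum fun m _ => hterm _ J (H.norm_pos m)
      _ ≤ _ := (H.summable_rpow hδ hδ1).sum_le_tsum _
          fun m _ => Real.rpow_nonneg (Nat.cast_nonneg _) _
  have hlim := (((hasSum_geometric_of_lt_one hρ0.le hρ1).tendsto_sum_nat.const_mul c).const_mul
    (1 - (q : ℝ)⁻¹))
  have hge := le_of_tendsto' hlim hJ
  refine le_trans ?_ hge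
  have h1 : 1 - (q : ℝ) ^ (-δ) ≤ δ * Real.log q := by
    rw [Real.rpow_def_of_pos hq0]
    have := Real.add_one_le_exp (Real.log q * -δ)
    linarith
  calc (1 - (q : ℝ)⁻¹) * c / Real.log q / δ = (1 - (q : ℝ)⁻¹) * (c * (δ * Real.log q)⁻¹) := by
        field_simp
    _ ≤ _ := by
        gcongr

theorem norm_rpow (N : P → ℕ) (m : P →₀ ℕ) (s : ℝ) :
    (norm N m : ℝ) ^ s = m.prod fun p n => ((N p : ℝ) ^ s) ^ n := by
  rw [norm, Finsupp.prod, Finsupp.prod, Nat.cast_prod, ← Real.finsetProd_rpow]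
  · refine Finset.prod_congr rfl fun p _ => ?_
    rw [Nat.cast_pow, ← Real.rpow_natCast, ← Real.rpow_natCast, ← Real.rpow_mul (by positivity),
      ← Real.rpow_mul (by positivity), mul_comm]
  · intro p _
    positivity

theorem constOn_injective {k : ℕ} (hk : k ≠ 0) :
    Function.Injective fun d : Finset P => constOn d k := by
  classical
  intro d e hde
  ext p
  have := DFunLike.congr_fun hde p
  simp only [constOn_apply] at this
  by_cases h1 : p ∈ d <;> by_cases h2 : p ∈ e <;> simp_all

/-- A finite form of the Euler product, as an inequality. -/
theorem sum_prod_pow_le_prod_inv (G : Finset (P →₀ ℕ)) (u : P → ℝ) (hu0 : ∀ p, 0 ≤ u p)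
    (hu1 : ∀ p, u p < 1) : ∃ F : Finset P,
    ∑ m ∈ G, (m.prod fun p n => u p ^ n) ≤ ∏ p ∈ F, (1 - u p)⁻¹ := by
  classical
  obtain ⟨F, hsub⟩ : ∃ F : Finset P, ∀ m ∈ G, m.support ⊆ F :=
    ⟨G.biUnion Finsupp.support, fun m hm => Finset.subset_biUnion_of_mem Finsupp.support hm⟩
  obtain ⟨K, hlt⟩ : ∃ K : ℕ, ∀ m ∈ G, ∀ p, m p < K := by
    refine ⟨G.sup (fun m => m.support.sup m) + 1, fun m hm p => ?_⟩
    rw [Nat.lt_succ_iff]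
    by_cases hp : p ∈ m.support
    · exact (Finset.le_sup (f := m) hp).trans
        (Finset.le_sup (f := fun m : P →₀ ℕ => m.support.sup m) hm)
    · rw [Finsupp.notMem_support_iff.1 hp]
      exact Nat.zero_le _
  refine ⟨F, ?_⟩
  calc ∑ m ∈ G, (m.prod fun p n => u p ^ n)
      = ∑ m ∈ G, ∏ x ∈ F.attach, u x.1 ^ m x.1 := by
        refine Finset.sum_congr rfl fun m hm => ?_
        have h1 : (m.prod fun p n => u p ^ n) = ∏ p ∈ F, u p ^ m p :=
          Finsupp.prod_of_support_subset m (hsub m hm) (fun p n => u p ^ n) fun _ _ => pow_zero _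
        rw [h1]
        exact (Finset.prod_attach F fun p => u p ^ m p).symm
    -- Exponent vectors are turned into dependent functions on F, the index type of
    -- `Finset.prod_sum`.
    _ = ∑ g ∈ G.image (fun (m : P →₀ ℕ) (p : P) (_ : p ∈ F) => m p),
          ∏ x ∈ F.attach, u x.1 ^ g x.1 x.2 := by
        rw [Finset.sum_image]
        intro m hm n hn hmn
        ext p
        by_cases hp : p ∈ F
        · exact congrFun (congrFun hmn p) hp
        · rw [Finsupp.notMem_support_iff.1 fun h => hp (hsub m hm h),
            Finsupp.notMem_support_iff.1 fun h => hp (hsub n hn h)]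
    _ ≤ ∑ g ∈ F.pi fun _ => Finset.range K, ∏ x ∈ F.attach, u x.1 ^ g x.1 x.2 := by
        refine Finset.sum_le_sum_of_subset_of_nonneg ?_ fun g _ _ =>
          Finset.prod_nonneg fun x _ => pow_nonneg (hu0 _) _
        intro g hg
        obtain ⟨m, hm, rfl⟩ := Finset.mem_image.1 hg
        exact Finset.mem_pi.2 fun p _ => Finset.mem_range.2 (hlt m hm p)
    _ = ∏ p ∈ F, ∑ k ∈ Finset.range K, u p ^ k := by rw [Finset.prod_sum]
    _ ≤ ∏ p ∈ F, (1 - u p)⁻¹ := by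
        refine Finset.prod_le_prod (fun p _ => Finset.sum_nonneg fun k _ => pow_nonneg (hu0 p) _) ?_
        exact fun p _ => sum_range_pow_le_inv (hu0 p) (hu1 p) K

theorem RegularCount.summable_prime_rpow (H : RegularCount N X κ θ C) {δ : ℝ} (h0 : 0 < δ)
    (h1 : δ ≤ 1) : Summable fun p : P => (N p : ℝ) ^ (-(1 + δ)) := by
  have := (H.summable_rpow h0 h1).comp_injective
    (i := fun p : P => Finsupp.single p 1) (Finsupp.single_left_injective one_ne_zero)
  refine this.congr fun p => ?_
  simp [norm]

theorem RegularCount.two_le (H : RegularCount N X κ θ C) (p : P) : (2 : ℝ) ≤ N p := by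
  exact_mod_cast H.one_lt p

/-- This finite constant later bounds the mean number of repeated primes, the Poisson error and the
number of small primes. -/
theorem RegularCount.summable_prime_sq (H : RegularCount N X κ θ C) :
    Summable fun p : P => ((N p : ℝ)⁻¹) ^ 2 := by
  refine (H.summable_prime_rpow one_pos le_rfl).congr fun p => ?_
  rw [show -(1 + 1 : ℝ) = -((2 : ℕ) : ℝ) by norm_num, Real.rpow_neg (by positivity),
    Real.rpow_natCast, inv_pow]

/-- The prime zeta function is `log (1 / δ) + O(1)` at `1 + δ`. -/
theorem RegularCount.exists_abs_tsum_prime_rpow_sub_log_le (H : RegularCount N X κ θ C) :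
    ∃ c : ℝ, 0 < c ∧ ∀ δ : ℝ, 0 < δ → δ ≤ 1 →
      |∑' p : P, (N p : ℝ) ^ (-(1 + δ)) - Real.log (1 / δ)| ≤ c := by
  classical
  obtain ⟨c₁, hc₁, h₁⟩ := H.exists_le_tsum_rpow
  obtain ⟨c₂, hc₂, h₂⟩ := H.exists_sum_rpow_le
  set Z := ∑' p : P, ((N p : ℝ)⁻¹) ^ 2 with hZ
  have hZ0 : 0 ≤ Z := tsum_nonneg fun p => by positivity
  refine ⟨|Real.log c₁| + |Real.log c₂| + 2 * Z + 1, by positivity, ?_⟩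
  intro δ hδ hδ1
  set u : P → ℝ := fun p => (N p : ℝ) ^ (-(1 + δ)) with hu
  have hu0 : ∀ p, 0 ≤ u p := fun p => Real.rpow_nonneg (Nat.cast_nonneg _) _
  have huinv : ∀ p, u p ≤ (N p : ℝ)⁻¹ := by
    intro p
    rw [← Real.rpow_neg_one]
    exact Real.rpow_le_rpow_of_exponent_le (by linarith [H.two_le p]) (by linarith)
  -- Every norm is at least 2, which keeps the local factors away from their pole uniformly in δ.
  have hu2 : ∀ p, u p ≤ 1 / 2 := by
    intro p
    refine (huinv p).trans ?_
    rw [one_div]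
    exact inv_anti₀ two_pos (H.two_le p)
  have husq : ∀ F : Finset P, ∑ p ∈ F, u p ^ 2 ≤ Z := by
    intro F
    calc _ ≤ ∑ p ∈ F, ((N p : ℝ)⁻¹) ^ 2 :=
          Finset.sum_le_sum fun p _ => pow_le_pow_left₀ (hu0 p) (huinv p) 2
      _ ≤ Z := H.summable_prime_sq.sum_le_tsum _ fun p _ => by positivity
  have hsum := H.summable_prime_rpow hδ hδ1
  have hlogdiv : ∀ c : ℝ, 0 < c → Real.log (c / δ) = Real.log c + Real.log (1 / δ) := by
    intro c hc
    rw [Real.log_div hc.ne' hδ.ne', Real.log_div one_ne_zero hδ.ne', Real.log_one]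
    ring
  rw [abs_le]
  constructor
  -- Lower bound: zeta is dominated by its Euler product, and (1 - u)⁻¹ ≤ exp(u + 2u²) for 0 ≤ u ≤
  -- 1/2.
  · have h3 : ∑' m : P →₀ ℕ, (norm N m : ℝ) ^ (-(1 + δ)) ≤ Real.exp (∑' p, u p + 2 * Z) := by
      refine (H.summable_rpow hδ hδ1).tsum_le_of_sum_le fun G => ?_
      obtain ⟨F, hF⟩ := sum_prod_pow_le_prod_inv G u hu0 fun p => by linarith [hu2 p]
      simp_rw [norm_rpow]
      refine hF.trans ?_
      calc ∏ p ∈ F, (1 - u p)⁻¹ ≤ ∏ p ∈ F, Real.exp (u p + 2 * u p ^ 2) := by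
            refine Finset.prod_le_prod (fun p _ => inv_nonneg.2 (by linarith [hu2 p]))
              fun p _ => ?_
            have h4 : 0 < 1 - u p := by linarith [hu2 p]
            have h5 : (1 - u p)⁻¹ = u p / (1 - u p) + 1 := by field_simp; ring
            rw [h5]
            refine (Real.add_one_le_exp _).trans (Real.exp_le_exp.2 ?_)
            rw [div_le_iff₀ h4]
            have := hu0 p
            have := hu2 p
            nlinarith [mul_nonneg (pow_nonneg (hu0 p) 2) (by linarith : 0 ≤ 1 / 2 - u p)]
        _ = Real.exp (∑ p ∈ F, u p + 2 * ∑ p ∈ F, u p ^ 2) := by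
            rw [← Real.exp_sum, Finset.sum_add_distrib, Finset.mul_sum]
        _ ≤ _ := by
            refine Real.exp_le_exp.2 (add_le_add (hsum.sum_le_tsum _ fun p _ => hu0 p) ?_)
            linarith [husq F]
    have h4 := (h₁ δ hδ hδ1).trans h3
    have h5 := Real.log_le_log (by positivity) h4
    rw [Real.log_exp, hlogdiv _ hc₁] at h5
    have := neg_abs_le (Real.log c₁)
    have := abs_nonneg (Real.log c₂)
    linarith
  -- Upper bound: the product of the 1 + u_p sums over squarefree elements only, hence is at most
  -- zeta, while exp(u - u²) ≤ 1 + u.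
  · have h3 : ∑' p, u p ≤ Real.log (c₂ / δ) + Z := by
      refine hsum.tsum_le_of_sum_le fun F => ?_
      have h4 : Real.exp (∑ p ∈ F, (u p - u p ^ 2)) ≤ c₂ / δ := by
        calc _ = ∏ p ∈ F, Real.exp (u p - u p ^ 2) := Real.exp_sum _ _
          _ ≤ ∏ p ∈ F, (1 + u p) := by
              refine Finset.prod_le_prod (fun p _ => (Real.exp_pos _).le) fun p _ => ?_
              have h5 : 0 < 1 + u p := by linarith [hu0 p]
              have h6 : u p - u p ^ 2 ≤ u p / (1 + u p) := by
                rw [le_div_iff₀ h5]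
                nlinarith [pow_nonneg (hu0 p) 3]
              refine (Real.exp_le_exp.2 h6).trans ?_
              have h7 := Real.add_one_le_exp (-(u p / (1 + u p)))
              have h8 : -(u p / (1 + u p)) + 1 = (1 + u p)⁻¹ := by field_simp; ring
              rw [h8, Real.exp_neg] at h7
              exact (inv_le_inv₀ h5 (Real.exp_pos _)).1 h7
          _ = ∑ d ∈ F.powerset, ∏ p ∈ d, u p := Finset.prod_one_add _
          _ = ∑ d ∈ F.powerset, (norm N (constOn d 1) : ℝ) ^ (-(1 + δ)) := by
              refine Finset.sum_congr rfl fun d _ => ?_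
              rw [norm_constOn]
              simp only [pow_one]
              rw [Nat.cast_prod, ← Real.finsetProd_rpow _ _ fun p _ => Nat.cast_nonneg _]
          _ = ∑ m ∈ F.powerset.image fun d => constOn d 1, (norm N m : ℝ) ^ (-(1 + δ)) := by
              rw [Finset.sum_image fun d _ e _ h => constOn_injective one_ne_zero h]
          _ ≤ _ := h₂ δ hδ hδ1 _
      have h5 := Real.log_le_log (Real.exp_pos _) h4
      rw [Real.log_exp, Finset.sum_sub_distrib] at h5
      linarith [husq F]
    rw [hlogdiv _ hc₂] at h3
    have := le_abs_self (Real.log c₂)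
    have := abs_nonneg (Real.log c₁)
    linarith

/-! ### Mertens' estimate -/

open Classical in
/-- The primes of norm at most `y`. -/
noncomputable def primesUpTo (N : P → ℕ) (y : ℝ) : Finset P :=
  if h : {p | (N p : ℝ) ≤ y}.Finite then h.toFinset else ∅

theorem RegularCount.mem_primesUpTo (H : RegularCount N X κ θ C) {y : ℝ} {p : P} :
    p ∈ primesUpTo N y ↔ (N p : ℝ) ≤ y := by
  have h : {p | (N p : ℝ) ≤ y}.Finite := by
    obtain ⟨n, hn⟩ := exists_nat_ge y
    refine Set.Finite.of_finite_image (f := fun p : P => Finsupp.single p 1)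
      ((H.finite n).subset ?_) (Finsupp.single_left_injective one_ne_zero).injOn
    rintro m ⟨p, hp, rfl⟩
    refine ⟨Set.mem_univ _, ?_⟩
    have h1 : (N p : ℝ) ≤ n := le_trans hp hn
    simp only [norm, pow_zero, Finsupp.prod_single_index, pow_one]
    exact_mod_cast h1
  rw [primesUpTo, dif_pos h]
  simp

/-- The sum of the reciprocals of the norms of the primes of norm at most `exp (exp T)`. -/
noncomputable def recipSum (N : P → ℕ) (T : ℝ) : ℝ :=
  ∑ p ∈ primesUpTo N (Real.exp (Real.exp T)), (N p : ℝ)⁻¹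

/-- A form of Mertens' theorem. -/
theorem RegularCount.exists_abs_recipSum_sub_le (H : RegularCount N X κ θ C) :
    ∃ c : ℝ, 0 < c ∧ ∀ T : ℝ, 3 ≤ T → |recipSum N T - T| ≤ c * Real.log T := by
  classical
  obtain ⟨c, hc, hcb⟩ := H.exists_abs_tsum_prime_rpow_sub_log_le
  refine ⟨4 * c + 8, by positivity, ?_⟩
  intro T hT
  have hT0 : 0 < T := by linarith
  have hlog1 : 1 ≤ Real.log T := by
    rw [Real.le_log_iff_exp_le hT0]
    exact (Real.exp_one_lt_d9.le.trans (by norm_num)).trans hT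
  have hexpT : T + 1 ≤ Real.exp T := Real.add_one_le_exp T
  have hNp : ∀ p : P, (0 : ℝ) < N p := fun p => by linarith [H.two_le p]
  have hlogexp : ∀ η : ℝ, 0 < η → Real.log (1 / (η * Real.exp (-T))) = T - Real.log η := by
    intro η hη
    rw [Real.log_div one_ne_zero (by positivity), Real.log_one, Real.log_mul hη.ne' (by positivity),
      Real.log_exp]
    ring
  have hlogle : ∀ p ∈ primesUpTo N (Real.exp (Real.exp T)), Real.log (N p) ≤ Real.exp T := by
    intro p hp
    rw [H.mem_primesUpTo] at hp
    rwa [Real.log_le_iff_le_exp (hNp p)]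
  have hup : recipSum N T ≤ (1 + 2 / T) * (T + Real.log T + c) := by
    -- For N(p) ≤ exp(exp T) this gives N(p)^δ ≤ exp(1/T), a relative loss of O(1/T), while log(1/δ)
    -- = T + log T.
    set δ := 1 / T * Real.exp (-T) with hδ
    have hδ0 : 0 < δ := by positivity
    have hδ1 : δ ≤ 1 := by
      rw [hδ]
      have h1 : 1 / T ≤ 1 := by rw [div_le_one hT0]; linarith
      have h2 : Real.exp (-T) ≤ 1 := Real.exp_le_one_iff.2 (by linarith)
      exact mul_le_one₀ h1 (Real.exp_pos _).le h2
    have h1 : recipSum N T ≤ Real.exp (1 / T) * ∑' p : P, (N p : ℝ) ^ (-(1 + δ)) := by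
      refine le_trans ?_ (mul_le_mul_of_nonneg_left
        ((H.summable_prime_rpow hδ0 hδ1).sum_le_tsum (primesUpTo N (Real.exp (Real.exp T)))
          fun p _ => Real.rpow_nonneg (Nat.cast_nonneg _) _) (Real.exp_pos _).le)
      rw [recipSum, Finset.mul_sum]
      refine Finset.sum_le_sum fun p hp => ?_
      rw [← Real.rpow_neg_one, Real.rpow_def_of_pos (hNp p), Real.rpow_def_of_pos (hNp p),
        ← Real.exp_add]
      refine Real.exp_le_exp.2 ?_
      have h2 : Real.log (N p) * δ ≤ 1 / T := by
        calc _ ≤ Real.exp T * δ := by gcongr; exact hlogle p hp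
          _ = 1 / T * (Real.exp T * Real.exp (-T)) := by rw [hδ]; ring
          _ = 1 / T := by rw [← Real.exp_add]; simp
      linarith
    have h2 := (abs_le.1 (hcb δ hδ0 hδ1)).2
    rw [hδ, hlogexp _ (by positivity), one_div, Real.log_inv] at h2
    have h3 : Real.exp (1 / T) ≤ 1 + 2 / T := by
      have hT3 : 1 / T ≤ 1 / 3 := one_div_le_one_div_of_le (by norm_num) hT
      have h4 := Real.exp_bound_div_one_sub_of_interval (x := 1 / T) (by positivity) (by linarith)
      refine h4.trans ?_
      rw [div_le_iff₀ (by linarith)]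
      have h5 : 2 / T = 2 * (1 / T) := by ring
      rw [h5]
      nlinarith [(by positivity : (0 : ℝ) < 1 / T)]
    refine h1.trans (mul_le_mul h3 ?_ (tsum_nonneg fun p => by positivity) (by positivity))
    rw [hδ, one_div]
    linarith
  have hlow : T - Real.log T - c - (T + c) / T ≤ recipSum N T := by
    -- Rankin's trick: beyond exp(exp T) one has N(p)^(-δ/2) ≤ 1/T, so the tail at 1 + δ is at most
    -- 1/T times the prime zeta value at 1 + δ/2, which is O(1).
    set δ := 2 * Real.log T * Real.exp (-T) with hδ
    have hδ0 : 0 < δ := by positivity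
    have hlogT : 2 * Real.log T ≤ T := by
      have h1 := Real.add_one_le_exp (Real.log T - 1)
      rw [Real.exp_sub, Real.exp_log hT0] at h1
      have h2 : T / Real.exp 1 ≤ T / 2 := by
        have := Real.exp_one_gt_d9
        gcongr
        linarith
      linarith
    have hδ1 : δ ≤ 1 := by
      rw [hδ]
      calc _ ≤ Real.exp T * Real.exp (-T) := by gcongr; linarith
        _ = 1 := by rw [← Real.exp_add]; simp
    have hs1 := H.summable_prime_rpow hδ0 hδ1
    have hs2 := H.summable_prime_rpow (half_pos hδ0) (by linarith)
    have h1 : ∑' p : P, (N p : ℝ) ^ (-(1 + δ)) ≤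
        recipSum N T + 1 / T * ∑' p : P, (N p : ℝ) ^ (-(1 + δ / 2)) := by
      have h2 := hs1.sum_add_tsum_subtype_compl (primesUpTo N (Real.exp (Real.exp T)))
      rw [← h2]
      refine add_le_add ?_ ?_
      · refine Finset.sum_le_sum fun p _ => ?_
        rw [← Real.rpow_neg_one]
        exact Real.rpow_le_rpow_of_exponent_le (by linarith [H.two_le p]) (by linarith)
      · rw [← tsum_mul_left]
        refine le_trans ?_ ((hs2.mul_left (1 / T)).tsum_subtype_le
          (fun p => 1 / T * (N p : ℝ) ^ (-(1 + δ / 2)))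
          {p | p ∉ primesUpTo N (Real.exp (Real.exp T))} (fun p => by positivity))
        refine Summable.tsum_le_tsum ?_ (hs1.subtype _) ((hs2.mul_left (1 / T)).subtype _)
        rintro ⟨p, hp⟩
        rw [H.mem_primesUpTo, not_le, ← Real.lt_log_iff_exp_lt (hNp p)] at hp
        have e : (1 : ℝ) / T = Real.exp (-Real.log T) := by
          rw [Real.exp_neg, Real.exp_log hT0, one_div]
        rw [e, Real.rpow_def_of_pos (hNp p), Real.rpow_def_of_pos (hNp p), ← Real.exp_add]
        refine Real.exp_le_exp.2 ?_
        have h3 : Real.log T ≤ Real.log (N p) * (δ / 2) := by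
          calc Real.log T = Real.log T * (Real.exp T * Real.exp (-T)) := by
                rw [← Real.exp_add]; simp
            _ = Real.exp T * (δ / 2) := by rw [hδ]; ring
            _ ≤ _ := by gcongr
        linarith
    have h2 := (abs_le.1 (hcb δ hδ0 hδ1)).1
    have h3 := (abs_le.1 (hcb (δ / 2) (by positivity) (by linarith))).2
    have e2 : δ / 2 = Real.log T * Real.exp (-T) := by rw [hδ]; ring
    rw [hδ, hlogexp _ (by positivity)] at h2
    rw [e2, hlogexp _ (by positivity)] at h3
    rw [← hδ] at h2
    rw [← e2] at h3
    have h4 : Real.log (2 * Real.log T) ≤ Real.log T := Real.log_le_log (by positivity) hlogT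
    have h5 : 0 ≤ Real.log (Real.log T) := Real.log_nonneg hlog1
    have h6 : 1 / T * ∑' p : P, (N p : ℝ) ^ (-(1 + δ / 2)) ≤ (T + c) / T := by
      rw [div_mul_eq_mul_div, one_mul]
      gcongr
      linarith
    linarith
  have hlogT : Real.log T ≤ T := by linarith [Real.log_le_sub_one_of_pos hT0]
  rw [abs_le]
  constructor
  · have : (T + c) / T ≤ 1 + c := by
      rw [div_le_iff₀ hT0]
      nlinarith
    nlinarith
  · have : (1 + 2 / T) * (T + Real.log T + c) ≤ T + Real.log T + c + 2 + 2 + 2 * c := by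
      have h1 : (1 + 2 / T) * (T + Real.log T + c) =
          T + Real.log T + c + 2 + 2 * (Real.log T / T) + 2 * c / T := by
        field_simp
        ring
      have h2 : Real.log T / T ≤ 1 := (div_le_one hT0).2 hlogT
      have h3 : 2 * c / T ≤ 2 * c := by
        rw [div_le_iff₀ hT0]
        nlinarith
      rw [h1]
      linarith
    nlinarith

/-! ### Comparison with independent and Poisson models -/

open Classical in
/-- The number of elements of bounded norm divisible by all points of `d`. -/
theorem RegularCount.sum_box_prod_boole {R : Type*} [CommSemiring R]
    (H : RegularCount N X κ θ C) (x : ℚ) (d : Finset P) :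
    ∑ m ∈ box N x, ∏ p ∈ d, (if p ∈ m.support then 1 else 0 : R) =
      (box N (x / norm N (constOn d 1))).card := by
  simp_rw [Finset.prod_boole]
  rw [Finset.sum_boole, ← H.card_box_filter_le]
  congr 2
  refine Finset.filter_congr fun m _ => ?_
  rw [constOn_le_iff]
  refine forall₂_congr fun p _ => ?_
  rw [Finsupp.mem_support_iff, Nat.one_le_iff_ne_zero]

theorem cast_norm_constOn_one (N : P → ℕ) (d : Finset P) :
    ((norm N (constOn d 1) : ℕ) : ℝ)⁻¹ = ∏ p ∈ d, (N p : ℝ)⁻¹ := by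
  rw [norm_constOn, Finset.prod_inv_distrib]
  simp

theorem RegularCount.inv_nonneg_le_one (H : RegularCount N X κ θ C) (p : P) :
    0 ≤ (N p : ℝ)⁻¹ ∧ (N p : ℝ)⁻¹ ≤ 1 :=
  ⟨by positivity, inv_le_one_of_one_le₀ (by linarith [H.two_le p])⟩

open Classical Finset in
/-- The mean of a multiplicative function of the set of prime divisors in `F` is close to its mean
in the independent model. -/
theorem RegularCount.norm_mean_prod_sub_le (H : RegularCount N X κ θ C) {x : ℚ} (hx : x ∈ X)
    (hx1 : 1 ≤ x) (F : Finset P) {w : ℂ} (hw : ‖1 + w‖ ≤ 1) (hw1 : ‖w‖ ≤ 1) (K : ℕ) :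
    ‖((x : ℝ) : ℂ)⁻¹ * ∑ m ∈ box N x, ∏ p ∈ F, (1 + w * ((if p ∈ m.support then 1 else 0 : ℝ) : ℂ))
        - κ * ∏ p ∈ F, (1 + w * (((N p : ℝ)⁻¹ : ℝ) : ℂ))‖ ≤
      C * (x : ℝ) ^ θ / x * ((F.card : ℝ) + 1) ^ K +
        (C + κ) * (‖w‖ ^ K * ∑ d ∈ powersetCard K F, ∏ p ∈ d, (N p : ℝ)⁻¹) := by
  have hx1' : (1 : ℝ) ≤ x := by exact_mod_cast hx1
  have hx0 : (0 : ℝ) < x := by linarith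
  have hC := H.const_pos
  have hκ := H.dens_pos
  have hux : ‖((x : ℝ) : ℂ)⁻¹‖ = (x : ℝ)⁻¹ := by
    rw [norm_inv, Complex.norm_real, Real.norm_of_nonneg hx0.le]
  set T : (P → ℝ) → ℂ := fun u =>
    ∑ j ∈ Finset.range K, w ^ j * ∑ d ∈ powersetCard j F, ∏ p ∈ d, (u p : ℂ) with hT
  set b : (P →₀ ℕ) → P → ℝ := fun m p => if p ∈ m.support then 1 else 0 with hb
  set v : P → ℝ := fun p => (N p : ℝ)⁻¹ with hv
  -- Three errors: truncation for the actual divisibility indicators, counts against densities in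
  -- the truncated sums, and truncation in the model.
  have e : ((x : ℝ) : ℂ)⁻¹ * ∑ m ∈ box N x, ∏ p ∈ F, (1 + w * (b m p : ℂ)) -
        κ * ∏ p ∈ F, (1 + w * (v p : ℂ)) =
      ((x : ℝ) : ℂ)⁻¹ * ∑ m ∈ box N x, (∏ p ∈ F, (1 + w * (b m p : ℂ)) - T (b m)) +
        (((x : ℝ) : ℂ)⁻¹ * ∑ m ∈ box N x, T (b m) - κ * T v) -
        κ * (∏ p ∈ F, (1 + w * (v p : ℂ)) - T v) := by
    rw [sum_sub_distrib]
    ring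
  rw [e]
  -- Averaging turns the truncation error for actual elements into that of the model, up to the
  -- factor C.
  have hcard : ∀ d : Finset P, (x : ℝ)⁻¹ * ((box N (x / norm N (constOn d 1))).card : ℝ) ≤
      C * ∏ p ∈ d, v p := by
    intro d
    have h1 := H.card_box_div_le hx (by linarith) (constOn d 1)
    rw [hv, ← cast_norm_constOn_one]
    calc _ ≤ (x : ℝ)⁻¹ * (C * (x / norm N (constOn d 1))) := by gcongr
      _ = _ := by field_simp
  have h1 : ‖((x : ℝ) : ℂ)⁻¹ * ∑ m ∈ box N x, (∏ p ∈ F, (1 + w * (b m p : ℂ)) - T (b m))‖ ≤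
      C * (‖w‖ ^ K * ∑ d ∈ powersetCard K F, ∏ p ∈ d, v p) := by
    rw [norm_mul, hux]
    calc _ ≤ (x : ℝ)⁻¹ * ∑ m ∈ box N x, ‖w‖ ^ K * ∑ d ∈ powersetCard K F, ∏ p ∈ d, b m p := by
          refine mul_le_mul_of_nonneg_left ((norm_sum_le _ _).trans (sum_le_sum fun m _ => ?_))
            (by positivity)
          refine norm_prod_one_add_sub_sum_powersetCard_le F (b m) ?_ ?_ w hw K
          · intro p
            simp only [hb]
            split_ifs <;> norm_num
          · intro p
            simp only [hb]
            split_ifs <;> norm_num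
      _ = ‖w‖ ^ K * ∑ d ∈ powersetCard K F,
            (x : ℝ)⁻¹ * ((box N (x / norm N (constOn d 1))).card : ℝ) := by
          rw [← mul_sum, sum_comm, ← mul_sum]
          simp_rw [hb, H.sum_box_prod_boole]
          ring
      _ ≤ ‖w‖ ^ K * ∑ d ∈ powersetCard K F, C * ∏ p ∈ d, v p := by
          exact mul_le_mul_of_nonneg_left (sum_le_sum fun d _ => hcard d) (by positivity)
      _ = _ := by
          rw [← mul_sum]
          ring
  have h2 : ‖((x : ℝ) : ℂ)⁻¹ * ∑ m ∈ box N x, T (b m) - κ * T v‖ ≤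
      C * (x : ℝ) ^ θ / x * ((F.card : ℝ) + 1) ^ K := by
    have e2 : ((x : ℝ) : ℂ)⁻¹ * ∑ m ∈ box N x, T (b m) - κ * T v =
        ∑ j ∈ Finset.range K, w ^ j * ∑ d ∈ powersetCard j F,
          (((x : ℝ)⁻¹ * (box N (x / norm N (constOn d 1))).card - κ * ∏ p ∈ d, v p : ℝ) : ℂ) := by
      simp only [hT]
      rw [sum_comm]
      simp_rw [← mul_sum]
      rw [mul_sum, mul_sum, ← sum_sub_distrib]
      refine sum_congr rfl fun j _ => ?_
      rw [sum_comm]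
      have : ∀ d : Finset P, ∑ m ∈ box N x, ∏ p ∈ d, (b m p : ℂ) =
          ((box N (x / norm N (constOn d 1))).card : ℂ) := by
        intro d
        rw [← H.sum_box_prod_boole]
        refine sum_congr rfl fun m _ => prod_congr rfl fun p _ => ?_
        simp only [hb]
        split_ifs <;> simp
      simp_rw [this]
      push_cast
      rw [sum_sub_distrib, ← mul_sum, ← mul_sum]
      ring
    rw [e2]
    have hd : ∀ d : Finset P,
        ‖(((x : ℝ)⁻¹ * (box N (x / norm N (constOn d 1))).card - κ * ∏ p ∈ d, v p : ℝ) : ℂ)‖ ≤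
          C * (x : ℝ) ^ θ / x := by
      intro d
      rw [Complex.norm_real, Real.norm_eq_abs]
      have hn : (1 : ℝ) ≤ norm N (constOn d 1) := by exact_mod_cast H.norm_pos _
      have hn' : (0 : ℚ) < norm N (constOn d 1) := by exact_mod_cast H.norm_pos _
      have h3 := H.approx _ (H.div_norm_mem hx (constOn d 1)) (by positivity) x hx1' (by
        push_cast
        exact div_le_self hx0.le hn)
      rw [hv, ← cast_norm_constOn_one]
      have e3 : (x : ℝ)⁻¹ * ((box N (x / norm N (constOn d 1))).card : ℝ) -
          κ * ((norm N (constOn d 1) : ℕ) : ℝ)⁻¹ = (x : ℝ)⁻¹ *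
          ((box N (x / norm N (constOn d 1))).card - κ * ((x / norm N (constOn d 1) : ℚ) : ℝ)) := by
        push_cast
        field_simp
      rw [e3, abs_mul, abs_of_pos (inv_pos.2 hx0), inv_mul_eq_div]
      gcongr
    calc _ ≤ ∑ j ∈ Finset.range K, ((F.card.choose j : ℝ) * (C * (x : ℝ) ^ θ / x)) := by
          refine (norm_sum_le _ _).trans (sum_le_sum fun j _ => ?_)
          rw [norm_mul, norm_pow]
          refine (mul_le_of_le_one_left (norm_nonneg _) (pow_le_one₀ (norm_nonneg _) hw1)).trans ?_
          refine (norm_sum_le_of_le _ fun d _ => hd d).trans ?_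
          rw [sum_const, card_powersetCard, nsmul_eq_mul]
      _ = C * (x : ℝ) ^ θ / x * ∑ j ∈ Finset.range K, (F.card.choose j : ℝ) := by
          rw [← sum_mul, mul_comm]
      _ ≤ _ := by
          gcongr
          exact sum_range_choose_le _ _
  have h3 : ‖(κ : ℂ) * (∏ p ∈ F, (1 + w * (v p : ℂ)) - T v)‖ ≤
      κ * (‖w‖ ^ K * ∑ d ∈ powersetCard K F, ∏ p ∈ d, v p) := by
    rw [norm_mul, Complex.norm_real, Real.norm_of_nonneg hκ.le]
    gcongr
    exact norm_prod_one_add_sub_sum_powersetCard_le F v (fun p => (H.inv_nonneg_le_one p).1)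
      (fun p => (H.inv_nonneg_le_one p).2) w hw K
  refine (norm_sub_le _ _).trans ?_
  refine (add_le_add (norm_add_le _ _) le_rfl).trans ?_
  linarith

/-- The mean in the independent model is close to that of a Poisson variable. -/
theorem RegularCount.norm_prod_sub_exp_le (H : RegularCount N X κ θ C) (F : Finset P) {w : ℂ}
    (hw : ‖1 + w‖ ≤ 1) (hw1 : ‖w‖ ≤ 1) :
    ‖∏ p ∈ F, (1 + w * (((N p : ℝ)⁻¹ : ℝ) : ℂ)) -
        Complex.exp (w * ((∑ p ∈ F, (N p : ℝ)⁻¹ : ℝ) : ℂ))‖ ≤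
      ‖w‖ ^ 2 * ∑' p : P, ((N p : ℝ)⁻¹) ^ 2 := by
  -- Re w ≤ 0 keeps the Poisson factors exp(w/N(p)) in the unit disc, so that the two products can
  -- be compared factor by factor.
  have hre : w.re ≤ 0 := by
    have := (Complex.re_le_norm (1 + w)).trans hw
    simp at this
    exact this
  have hv := H.inv_nonneg_le_one
  rw [Complex.ofReal_sum, Finset.mul_sum, Complex.exp_sum]
  refine (norm_prod_sub_prod_le F _ _ ?_ ?_).trans ?_
  · intro p _
    have : 1 + w * (((N p : ℝ)⁻¹ : ℝ) : ℂ) =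
        ((1 - (N p : ℝ)⁻¹ : ℝ) : ℂ) + (((N p : ℝ)⁻¹ : ℝ) : ℂ) * (1 + w) := by push_cast; ring
    rw [this]
    refine (norm_add_le _ _).trans ?_
    rw [norm_mul, Complex.norm_real, Complex.norm_real, Real.norm_of_nonneg (hv p).1,
      Real.norm_of_nonneg (sub_nonneg.2 (hv p).2)]
    nlinarith [(hv p).1]
  · intro p _
    rw [Complex.norm_exp]
    refine Real.exp_le_one_iff.2 ?_
    rw [Complex.re_mul_ofReal]
    exact mul_nonpos_of_nonpos_of_nonneg hre (hv p).1
  · calc _ ≤ ∑ p ∈ F, ‖w‖ ^ 2 * ((N p : ℝ)⁻¹) ^ 2 := by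
          refine Finset.sum_le_sum fun p _ => ?_
          have hn : ‖w * (((N p : ℝ)⁻¹ : ℝ) : ℂ)‖ = ‖w‖ * (N p : ℝ)⁻¹ := by
            rw [norm_mul, Complex.norm_real, Real.norm_of_nonneg (hv p).1]
          have h1 := Complex.norm_exp_sub_one_sub_id_le (x := w * (((N p : ℝ)⁻¹ : ℝ) : ℂ)) (by
            rw [hn]
            exact mul_le_one₀ hw1 (hv p).1 (hv p).2)
          rw [hn, mul_pow, ← norm_neg] at h1
          refine le_of_eq_of_le ?_ h1
          congr 1
          ring
      _ ≤ _ := by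
          rw [← Finset.mul_sum]
          gcongr
          exact H.summable_prime_sq.sum_le_tsum _ fun p _ => by positivity

open Classical in
/-- The first moment of the number of prime divisors in `F`. -/
theorem RegularCount.sum_box_card_filter_le (H : RegularCount N X κ θ C) {x : ℚ} (hx : x ∈ X)
    (hx0 : 0 < x) (F : Finset P) :
    ∑ m ∈ box N x, ((F.filter fun p => p ∈ m.support).card : ℝ) ≤
      C * x * ∑ p ∈ F, (N p : ℝ)⁻¹ := by
  calc _ = ∑ p ∈ F, ∑ m ∈ box N x, (if p ∈ m.support then 1 else 0 : ℝ) := by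
        rw [Finset.sum_comm]
        simp_rw [Finset.sum_boole]
    _ ≤ ∑ p ∈ F, C * x * (N p : ℝ)⁻¹ := by
        refine Finset.sum_le_sum fun p _ => ?_
        have h1 := H.sum_box_prod_boole (R := ℝ) x {p}
        simp only [Finset.prod_singleton] at h1
        rw [h1]
        refine (H.card_box_div_le hx hx0 _).trans (le_of_eq ?_)
        rw [norm_constOn]
        simp
        ring
    _ = _ := by rw [Finset.mul_sum]

theorem norm_exp_mul_I_sub_one_le (s : ℝ) : ‖Complex.exp (s * Complex.I) - 1‖ ≤ |s| := by
  have := norm_exp_mul_I_sub_exp_mul_I_le s 0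
  simpa using this

open Classical in
/-- Explicit bound for the difference between the characteristic function of the number of prime
divisors and that of a Poisson variable. -/
theorem RegularCount.norm_mean_exp_card_support_sub_le (H : RegularCount N X κ θ C) {x : ℚ}
    (hx : x ∈ X) (hx1 : 1 ≤ x) {F F₁ : Finset P} (hF : F ⊆ F₁)
    (hF₁ : ∀ m ∈ box N x, m.support ⊆ F₁) {s : ℝ} (hs : |s| ≤ 1) (K : ℕ) :
    ‖((x : ℝ) : ℂ)⁻¹ * ∑ m ∈ box N x, Complex.exp (s * m.support.card * Complex.I) -
        κ * Complex.exp ((Complex.exp (s * Complex.I) - 1) * ((∑ p ∈ F, (N p : ℝ)⁻¹ : ℝ) : ℂ))‖ ≤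
      |s| * (C * (∑ p ∈ F₁, (N p : ℝ)⁻¹ - ∑ p ∈ F, (N p : ℝ)⁻¹)) +
      C * (x : ℝ) ^ θ / x * ((F.card : ℝ) + 1) ^ K +
      (C + κ) * Real.exp (8 * |s| * ∑ p ∈ F, (N p : ℝ)⁻¹ - 2 * K) +
      κ * (|s| ^ 2 * ∑' p : P, ((N p : ℝ)⁻¹) ^ 2) := by
  have hx1' : (1 : ℝ) ≤ x := by exact_mod_cast hx1
  have hx0 : (0 : ℝ) < x := by linarith
  have hC := H.const_pos
  have hκ := H.dens_pos
  set w := Complex.exp (s * Complex.I) - 1 with hw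
  have hws : ‖w‖ ≤ |s| := norm_exp_mul_I_sub_one_le s
  have hw1 : ‖1 + w‖ ≤ 1 := by rw [hw, add_sub_cancel, Complex.norm_exp_ofReal_mul_I]
  have hprod : ∀ m : P →₀ ℕ, ∏ p ∈ F, (1 + w * ((if p ∈ m.support then 1 else 0 : ℝ) : ℂ)) =
      Complex.exp (s * (F.filter fun p => p ∈ m.support).card * Complex.I) := by
    intro m
    have : ∀ p, 1 + w * ((if p ∈ m.support then 1 else 0 : ℝ) : ℂ) =
        if p ∈ m.support then Complex.exp (s * Complex.I) else 1 := by
      intro p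
      split_ifs <;> simp [hw]
    simp_rw [this]
    rw [← Finset.prod_filter, Finset.prod_const, ← Complex.exp_nat_mul]
    congr 1
    ring
  set D := ((x : ℝ) : ℂ)⁻¹ * ∑ m ∈ box N x,
    ∏ p ∈ F, (1 + w * ((if p ∈ m.support then 1 else 0 : ℝ) : ℂ)) with hD
  set E := ∏ p ∈ F, (1 + w * (((N p : ℝ)⁻¹ : ℝ) : ℂ)) with hE
  -- Dropping the primes of F₁ \ F changes the phase by s times their number in m, so it costs |s|
  -- times the mean of that number.
  have h1 : ‖((x : ℝ) : ℂ)⁻¹ * ∑ m ∈ box N x, Complex.exp (s * m.support.card * Complex.I) - D‖ ≤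
      |s| * (C * (∑ p ∈ F₁, (N p : ℝ)⁻¹ - ∑ p ∈ F, (N p : ℝ)⁻¹)) := by
    rw [hD, ← mul_sub, ← Finset.sum_sub_distrib, norm_mul, norm_inv, Complex.norm_real,
      Real.norm_of_nonneg hx0.le]
    have h2 : ‖∑ m ∈ box N x, (Complex.exp (s * m.support.card * Complex.I) -
          ∏ p ∈ F, (1 + w * ((if p ∈ m.support then 1 else 0 : ℝ) : ℂ)))‖ ≤
        ∑ m ∈ box N x, |s| * (((F₁ \ F).filter fun p => p ∈ m.support).card : ℝ) := by
      refine norm_sum_le_of_le _ fun m hm => ?_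
      rw [hprod]
      have h3 := norm_exp_mul_I_sub_exp_mul_I_le (s * m.support.card)
        (s * (F.filter fun p => p ∈ m.support).card)
      push_cast at h3
      refine h3.trans (le_of_eq ?_)
      rw [← mul_sub, abs_mul]
      congr 1
      have h4 : m.support = F₁.filter fun p => p ∈ m.support := by
        ext p
        rw [Finset.mem_filter]
        exact ⟨fun hp => ⟨hF₁ m hm hp, hp⟩, fun hp => hp.2⟩
      have h5 : (m.support.card : ℝ) = (((F₁ \ F).filter fun p => p ∈ m.support).card : ℝ) +
          ((F.filter fun p => p ∈ m.support).card : ℝ) := by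
        nth_rewrite 1 [h4]
        rw [← Finset.sdiff_union_of_subset hF, Finset.filter_union, Finset.card_union_of_disjoint]
        · push_cast
          rw [Finset.sdiff_union_of_subset hF]
        · exact Finset.disjoint_filter_filter Finset.sdiff_disjoint
      rw [h5, add_sub_cancel_right, abs_of_nonneg (Nat.cast_nonneg _)]
    rw [← Finset.mul_sum] at h2
    have h6 := H.sum_box_card_filter_le hx (by linarith) (F₁ \ F)
    have h7 := Finset.sum_sdiff (f := fun p => (N p : ℝ)⁻¹) hF
    rw [← h7, add_sub_cancel_right]
    calc _ ≤ (x : ℝ)⁻¹ * (|s| * (C * x * ∑ p ∈ F₁ \ F, (N p : ℝ)⁻¹)) := by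
          gcongr
          refine h2.trans ?_
          gcongr
      _ = _ := by field_simp
  have h2 := H.norm_mean_prod_sub_le hx hx1 F hw1 (hws.trans hs) K
  have h3 := H.norm_prod_sub_exp_le F hw1 (hws.trans hs)
  -- The factor exp(2K) is inserted and removed: weighting each prime by e²|s| ≤ 8|s| bounds the
  -- symmetric sum and leaves a gain of exp(-2K).
  have h4 : ‖w‖ ^ K * ∑ d ∈ Finset.powersetCard K F, ∏ p ∈ d, (N p : ℝ)⁻¹ ≤
      Real.exp (8 * |s| * ∑ p ∈ F, (N p : ℝ)⁻¹ - 2 * K) := by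
    have h5 := pow_mul_sum_powersetCard_le_exp F (fun p => (N p : ℝ)⁻¹)
      (fun p => (H.inv_nonneg_le_one p).1) (r := Real.exp 2 * |s|) (by positivity) K
    have he : Real.exp 2 ≤ 8 := by
      have h6 := Real.exp_one_lt_d9
      have h7 : Real.exp 2 = Real.exp 1 * Real.exp 1 := by
        rw [← Real.exp_add]
        norm_num
      rw [h7]
      nlinarith [Real.exp_pos 1]
    have hsum0 : 0 ≤ ∑ p ∈ F, (N p : ℝ)⁻¹ := Finset.sum_nonneg fun p _ => by positivity
    have hsum1 : 0 ≤ ∑ d ∈ Finset.powersetCard K F, ∏ p ∈ d, (N p : ℝ)⁻¹ :=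
      Finset.sum_nonneg fun d _ => Finset.prod_nonneg fun p _ => by positivity
    calc _ ≤ |s| ^ K * ∑ d ∈ Finset.powersetCard K F, ∏ p ∈ d, (N p : ℝ)⁻¹ := by gcongr
      _ = Real.exp (-(2 * K)) * ((Real.exp 2 * |s|) ^ K *
            ∑ d ∈ Finset.powersetCard K F, ∏ p ∈ d, (N p : ℝ)⁻¹) := by
          have : Real.exp (-(2 * (K : ℝ))) * Real.exp 2 ^ K = 1 := by
            rw [← Real.exp_nat_mul, ← Real.exp_add]
            simp [mul_comm]
          rw [mul_pow]
          linear_combination (-(|s| ^ K *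
            ∑ d ∈ Finset.powersetCard K F, ∏ p ∈ d, (N p : ℝ)⁻¹)) * this
      _ ≤ Real.exp (-(2 * K)) * Real.exp (8 * |s| * ∑ p ∈ F, (N p : ℝ)⁻¹) := by
          gcongr
          refine h5.trans (Real.exp_le_exp.2 ?_)
          gcongr
      _ = _ := by
          rw [← Real.exp_add]
          congr 1
          ring
  have hZ : 0 ≤ ∑' p : P, ((N p : ℝ)⁻¹) ^ 2 := tsum_nonneg fun p => by positivity
  have h5 : ‖κ * E - κ * Complex.exp (w * ((∑ p ∈ F, (N p : ℝ)⁻¹ : ℝ) : ℂ))‖ ≤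
      κ * (|s| ^ 2 * ∑' p : P, ((N p : ℝ)⁻¹) ^ 2) := by
    rw [← mul_sub, norm_mul, Complex.norm_real, Real.norm_of_nonneg hκ.le]
    gcongr
    refine h3.trans ?_
    gcongr
  have h6 := (add_le_add (add_le_add h1 h2) h5)
  refine le_trans ?_ (h6.trans ?_)
  · refine le_trans (le_of_eq ?_) ((norm_add_le _ _).trans (add_le_add (norm_add_le _ _) le_rfl))
    congr 1
    ring
  · have h7 : (C + κ) * (‖w‖ ^ K * ∑ d ∈ Finset.powersetCard K F, ∏ p ∈ d, (N p : ℝ)⁻¹) ≤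
        (C + κ) * Real.exp (8 * |s| * ∑ p ∈ F, (N p : ℝ)⁻¹ - 2 * K) := by gcongr
    linarith

/-- A crude bound for the number of primes of norm at most `y`. -/
theorem RegularCount.card_primesUpTo_le (H : RegularCount N X κ θ C) (y : ℝ) :
    ((primesUpTo N y).card : ℝ) ≤ (∑' p : P, ((N p : ℝ)⁻¹) ^ 2) * y ^ 2 := by
  calc ((primesUpTo N y).card : ℝ) = ∑ p ∈ primesUpTo N y, (1 : ℝ) := by simp
    _ ≤ ∑ p ∈ primesUpTo N y, ((N p : ℝ)⁻¹) ^ 2 * y ^ 2 := by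
        refine Finset.sum_le_sum fun p hp => ?_
        rw [H.mem_primesUpTo] at hp
        have h0 := H.two_le p
        rw [← mul_pow]
        refine one_le_pow₀ ?_
        rw [inv_mul_eq_div, one_le_div (by linarith)]
        exact hp
    _ ≤ _ := by
        rw [← Finset.sum_mul]
        gcongr
        exact H.summable_prime_sq.sum_le_tsum _ fun p _ => by positivity

/-! ### The normal limit for the number of primes, over all elements -/

theorem tendsto_ratCast_atTopIn (X : Set ℚ) :
    Tendsto (fun x : ℚ => (x : ℝ)) (atTopIn X) atTop :=
  (tendsto_ratCast_atTop_iff.2 tendsto_id).mono_left inf_le_left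

theorem tendsto_log_log_atTopIn (X : Set ℚ) :
    Tendsto (fun x : ℚ => Real.log (Real.log x)) (atTopIn X) atTop :=
  Real.tendsto_log_atTop.comp (Real.tendsto_log_atTop.comp (tendsto_ratCast_atTopIn X))

theorem eventually_mem_atTopIn (X : Set ℚ) : ∀ᶠ x in atTopIn X, x ∈ X :=
  eventually_inf_principal.2 (Eventually.of_forall fun _ h => h)

theorem RegularCount.support_subset (H : RegularCount N X κ θ C) {x : ℚ} {y : ℝ} (hxy : (x : ℝ) ≤ y)
    {m : P →₀ ℕ} (hm : m ∈ box N x) : m.support ⊆ primesUpTo N y := by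
  intro p hp
  rw [H.mem_primesUpTo]
  rw [H.mem_box] at hm
  have h1 : N p ∣ norm N m :=
    (dvd_pow_self _ (Finsupp.mem_support_iff.1 hp)).trans (Finset.dvd_prod_of_mem _ hp)
  have h2 : ((N p : ℕ) : ℝ) ≤ norm N m := by exact_mod_cast Nat.le_of_dvd (H.norm_pos m) h1
  have h3 : (norm N m : ℝ) ≤ x := by exact_mod_cast hm
  linarith

/-- The characteristic function of the normalized number of prime divisors converges to that of
the normal law, for any normalization `ℓ` close to `log log x`. -/
theorem RegularCount.tendsto_mean_exp (H : RegularCount N X κ θ C) (ℓ : ℚ → ℝ)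
    (hℓ : Tendsto (fun x : ℚ => ℓ x - Real.log (Real.log x)) (atTopIn X) (𝓝 0)) (t : ℝ) :
    Tendsto (fun x : ℚ => ((x : ℝ) : ℂ)⁻¹ * ∑ m ∈ box N x,
        Complex.exp (((t * ((m.support.card - ℓ x) / √(ℓ x)) : ℝ) : ℂ) * Complex.I))
      (atTopIn X) (𝓝 (κ * Complex.exp (-t ^ 2 / 2))) := by
  classical
  have hC := H.const_pos
  have hκ := H.dens_pos
  set l := atTopIn X with hl
  set T : ℚ → ℝ := fun x => Real.log (Real.log x) with hTdef
  have hT : Tendsto T l atTop := tendsto_log_log_atTopIn X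
  obtain ⟨c, hc, hmert⟩ := H.exists_abs_recipSum_sub_le
  set Z := ∑' p : P, ((N p : ℝ)⁻¹) ^ 2 with hZ
  have hZ0 : 0 ≤ Z := tsum_nonneg fun p => by positivity
  have hℓtop : Tendsto ℓ l atTop := by
    have := hℓ.add_atTop hT
    refine this.congr fun x => ?_
    ring
  have hsT : Tendsto (fun x => √(T x)) l atTop := Real.tendsto_sqrt_atTop.comp hT
  have hsℓ : Tendsto (fun x => √(ℓ x)) l atTop := Real.tendsto_sqrt_atTop.comp hℓtop
  have hlogT : Tendsto (fun x => Real.log (T x) / √(T x)) l (𝓝 0) := by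
    have h1 := (isLittleO_log_rpow_atTop (r := 1 / 2) (by norm_num)).tendsto_div_nhds_zero
    refine (h1.comp hT).congr fun x => ?_
    simp [Real.sqrt_eq_rpow]
  -- T ≥ 6 gives T - log T ≥ T/2 ≥ 3, the range of the Mertens estimate.
  have hTbig := hT.eventually_ge_atTop 6
  have hℓ1 := hℓtop.eventually_ge_atTop 1
  have hratio : Tendsto (fun x => T x / ℓ x) l (𝓝 1) := by
    have h1 : Tendsto (fun x => 1 - (ℓ x - T x) / ℓ x) l (𝓝 (1 - 0)) :=
      tendsto_const_nhds.sub (hℓ.div_atTop hℓtop)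
    rw [sub_zero] at h1
    refine h1.congr' ?_
    filter_upwards [hℓ1] with x hx
    field_simp
    ring
  have hsratio : Tendsto (fun x => √(T x) / √(ℓ x)) l (𝓝 1) := by
    have h1 := (Real.continuous_sqrt.tendsto 1).comp hratio
    rw [Real.sqrt_one] at h1
    refine h1.congr' ?_
    filter_upwards [hTbig] with x hx
    simp only [Function.comp_apply]
    rw [Real.sqrt_div (by linarith)]
  -- The cut-off exp(exp(T - log T)) is x^(1/T). It discards only O(log T) of the mean, yet products
  -- of about √T such primes remain x^(o(1)).
  set μ : ℚ → ℝ := fun x => recipSum N (T x - Real.log (T x)) with hμ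
  set μ₁ : ℚ → ℝ := fun x => recipSum N (T x) with hμ₁
  have hμT : ∀ᶠ x in l, |μ x - T x| ≤ (c + 1) * Real.log (T x) := by
    filter_upwards [hTbig] with x hx
    have h1 : Real.log (T x) ≤ T x / 2 := by
      have h2 := Real.add_one_le_exp (Real.log (T x) - 1)
      rw [Real.exp_sub, Real.exp_log (by linarith)] at h2
      have h3 : T x / Real.exp 1 ≤ T x / 2 := by
        have := Real.exp_one_gt_d9
        gcongr
        linarith
      linarith
    have h0 : 0 ≤ Real.log (T x) := Real.log_nonneg (by linarith)
    have h2 := hmert (T x - Real.log (T x)) (by linarith)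
    have h3 : Real.log (T x - Real.log (T x)) ≤ Real.log (T x) :=
      Real.log_le_log (by linarith) (by linarith)
    have h4 : |μ x - (T x - Real.log (T x))| ≤ c * Real.log (T x) := h2.trans (by gcongr)
    rw [abs_le] at h4 ⊢
    constructor <;> nlinarith
  have hμ₁T : ∀ᶠ x in l, |μ₁ x - T x| ≤ c * Real.log (T x) := by
    filter_upwards [hTbig] with x hx
    exact hmert (T x) (by linarith)
  have hμTs : Tendsto (fun x => (μ x - T x) / √(T x)) l (𝓝 0) := by
    have h1 := hlogT.const_mul (c + 1)
    rw [mul_zero] at h1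
    refine squeeze_zero_norm' ?_ h1
    filter_upwards [hμT] with x hx
    rw [norm_div, Real.norm_eq_abs, Real.norm_of_nonneg (Real.sqrt_nonneg _), ← mul_div_assoc]
    gcongr
  have hμℓ : Tendsto (fun x => (μ x - ℓ x) / √(ℓ x)) l (𝓝 0) := by
    have h1 := (hμTs.sub (hℓ.div_atTop hsT)).mul hsratio
    rw [sub_zero, zero_mul] at h1
    refine h1.congr' ?_
    filter_upwards [hTbig, hℓ1] with x hx hx'
    have h2 : 0 < √(T x) := Real.sqrt_pos.2 (by linarith)
    have h3 : 0 < √(ℓ x) := Real.sqrt_pos.2 (by linarith)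
    field_simp
    ring
  have hμℓ1 : Tendsto (fun x => μ x / ℓ x) l (𝓝 1) := by
    have h1 := (hμℓ.div_atTop hsℓ).const_add 1
    rw [add_zero] at h1
    refine h1.congr' ?_
    filter_upwards [hℓ1] with x hx
    have h3 : 0 < √(ℓ x) := Real.sqrt_pos.2 (by linarith)
    rw [div_div, Real.mul_self_sqrt (by linarith)]
    field_simp
    ring
  set s : ℚ → ℝ := fun x => t / √(ℓ x) with hs
  have hs0 : Tendsto s l (𝓝 0) := tendsto_const_nhds.div_atTop hsℓ
  have hs1 : ∀ᶠ x in l, |s x| ≤ 1 := by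
    have := hs0.abs
    rw [abs_zero] at this
    exact this.eventually_le_const one_pos
  -- Eventually the mean is at most 2ℓ, so 8|s|μ ≤ 16|t|√ℓ, and this K makes the exponent 8|s|μ - 2K
  -- at most -2√ℓ.
  set K : ℚ → ℕ := fun x => ⌈(8 * |t| + 1) * √(ℓ x)⌉₊ with hK
  -- the main term
  have hmain : Tendsto (fun x => (κ : ℂ) * Complex.exp ((Complex.exp (s x * Complex.I) - 1) * (μ x : ℂ)
      - (s x * ℓ x : ℝ) * Complex.I)) l (𝓝 (κ * Complex.exp (-t ^ 2 / 2))) := by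
    refine ((Complex.continuous_exp.tendsto _).comp ?_).const_mul _
    -- The exponent splits into a cubic remainder, a linear term is(μ - ℓ), which vanishes because μ
    -- - ℓ = o(√ℓ), and a quadratic term tending to -t²/2.
    have h1 : Tendsto (fun x => (Complex.exp (s x * Complex.I) - 1 - s x * Complex.I +
        s x ^ 2 / 2) * (μ x : ℂ)) l (𝓝 0) := by
      have h2 : Tendsto (fun x => |t| ^ 3 * ((√(ℓ x))⁻¹ * |μ x / ℓ x|)) l (𝓝 (|t| ^ 3 * (0 * |1|))) :=
        ((tendsto_inv_atTop_zero.comp hsℓ).mul hμℓ1.abs).const_mul _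
      rw [zero_mul, mul_zero] at h2
      refine squeeze_zero_norm' ?_ h2
      filter_upwards [hs1, hℓ1] with x hx hx'
      rw [norm_mul, Complex.norm_real, Real.norm_eq_abs]
      have h3 : 0 < √(ℓ x) := Real.sqrt_pos.2 (by linarith)
      have h4 : √(ℓ x) ^ 2 = ℓ x := Real.sq_sqrt (by linarith)
      calc _ ≤ |s x| ^ 3 * |μ x| := by gcongr; exact norm_exp_mul_I_sub_one_sub_le hx
        _ = _ := by
          have h5 : |μ x / ℓ x| = |μ x| / √(ℓ x) ^ 2 := by
            rw [abs_div, h4, abs_of_pos (by linarith : 0 < ℓ x)]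
          simp only [hs]
          rw [h5, abs_div, abs_of_pos h3]
          field_simp
    have h2 : Tendsto (fun x => ((t * ((μ x - ℓ x) / √(ℓ x)) : ℝ) : ℂ) * Complex.I) l (𝓝 0) := by
      have h3 := hμℓ.const_mul t
      rw [mul_zero] at h3
      have h4 := ((Complex.continuous_ofReal.tendsto 0).comp h3).mul_const Complex.I
      simpa using h4
    have h3 : Tendsto (fun x => ((t ^ 2 / 2 * (μ x / ℓ x) : ℝ) : ℂ)) l (𝓝 (t ^ 2 / 2 : ℂ)) := by
      have h4 := (Complex.continuous_ofReal.tendsto _).comp (hμℓ1.const_mul (t ^ 2 / 2))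
      have e : ((t ^ 2 / 2 * 1 : ℝ) : ℂ) = t ^ 2 / 2 := by push_cast; ring
      rw [e] at h4
      exact h4
    have h4 := (h1.add h2).sub h3
    rw [add_zero, zero_sub] at h4
    have e : -((t : ℂ) ^ 2 / 2) = -t ^ 2 / 2 := by ring
    rw [e] at h4
    refine h4.congr' ?_
    filter_upwards [hℓ1] with x hx
    have h3 : 0 < √(ℓ x) := Real.sqrt_pos.2 (by linarith)
    have h4 : √(ℓ x) ^ 2 = ℓ x := Real.sq_sqrt (by linarith)
    have e1 : t ^ 2 / 2 * (μ x / ℓ x) = s x ^ 2 / 2 * μ x := by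
      simp only [hs]
      rw [div_pow, h4]
      ring
    have e2 : t * ((μ x - ℓ x) / √(ℓ x)) = s x * μ x - s x * ℓ x := by
      simp only [hs]
      ring
    rw [e1, e2]
    push_cast
    ring
  -- the error terms
  have herr1 : Tendsto (fun x => |s x| * (C * (μ₁ x - μ x))) l (𝓝 0) := by
    have h1 := ((hlogT.mul hsratio).const_mul (|t| * C * (2 * c + 1)))
    rw [zero_mul, mul_zero] at h1
    refine squeeze_zero_norm' ?_ h1
    filter_upwards [hμT, hμ₁T, hTbig, hℓ1] with x h2 h3 h4 h5
    have h6 : 0 < √(T x) := Real.sqrt_pos.2 (by linarith)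
    have h7 : 0 < √(ℓ x) := Real.sqrt_pos.2 (by linarith)
    have h8 : |μ₁ x - μ x| ≤ (2 * c + 1) * Real.log (T x) := by
      rw [abs_le] at h2 h3 ⊢
      constructor <;> linarith
    rw [norm_mul, norm_mul, Real.norm_eq_abs, abs_abs, Real.norm_of_nonneg hC.le, Real.norm_eq_abs]
    calc |s x| * (C * |μ₁ x - μ x|) ≤ |s x| * (C * ((2 * c + 1) * Real.log (T x))) := by gcongr
      _ = _ := by
        simp only [hs]
        rw [abs_div, abs_of_pos h7]
        field_simp
  have hxexp : ∀ᶠ x : ℚ in l, (x : ℝ) = Real.exp (Real.exp (T x)) := by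
    have h1 := (tendsto_ratCast_atTopIn X).eventually_gt_atTop 1
    filter_upwards [h1] with x hx
    simp only [hTdef]
    rw [Real.exp_log (Real.log_pos hx), Real.exp_log (by linarith)]
  have herr2 : Tendsto (fun x : ℚ => C * (x : ℝ) ^ θ / x *
      (((primesUpTo N (Real.exp (Real.exp (T x - Real.log (T x))))).card : ℝ) + 1) ^ K x) l
      (𝓝 0) := by
    have hθ := H.exp_lt_one
    have h1 : Tendsto (fun x => C * Real.exp (-((1 - θ) / 2 * Real.exp (T x)))) l (𝓝 (C * 0)) := by
      refine (Real.tendsto_exp_neg_atTop_nhds_zero.comp ?_).const_mul C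
      exact (Real.tendsto_exp_atTop.comp hT).const_mul_atTop (by linarith)
    rw [mul_zero] at h1
    refine squeeze_zero' ?_ ?_ h1
    · filter_upwards [(tendsto_ratCast_atTopIn X).eventually_gt_atTop 0] with x hx
      positivity
    set c₃ := (8 * |t| + 2) * 2 with hc₃
    have hc₃0 : 0 < c₃ := by positivity
    have hsq : ∀ᶠ x in l, √(ℓ x) ≤ 2 * √(T x) := by
      have h2 := hratio.eventually_const_le (show (1 / 4 : ℝ) < 1 by norm_num)
      filter_upwards [h2, hℓ1] with x hx hx'
      rw [le_div_iff₀ (by linarith)] at hx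
      refine Real.sqrt_le_iff.2 ⟨by positivity, ?_⟩
      rw [mul_pow, Real.sq_sqrt (by linarith)]
      linarith
    have hexpdiv := ((Real.tendsto_exp_div_pow_atTop 1).comp hT).eventually_ge_atTop Z
    have hsTbig := hsT.eventually_ge_atTop (6 * c₃ / (1 - θ))
    filter_upwards [hxexp, hTbig, hℓ1, hsq, hexpdiv, hsTbig] with x hx hx6 hxℓ hxs hxZ hxT
    have hT0 : 0 < T x := by linarith
    have hsT0 : 0 < √(T x) := Real.sqrt_pos.2 hT0
    have hsqT : √(T x) * √(T x) = T x := Real.mul_self_sqrt hT0.le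
    simp only [Function.comp_apply, pow_one] at hxZ
    have hKle : (K x : ℝ) ≤ c₃ * √(T x) := by
      have h2 : 1 ≤ √(ℓ x) := Real.one_le_sqrt.2 hxℓ
      have h3 : (K x : ℝ) ≤ (8 * |t| + 1) * √(ℓ x) + 1 := (Nat.ceil_lt_add_one (by positivity)).le
      calc (K x : ℝ) ≤ (8 * |t| + 2) * √(ℓ x) := by linarith
        _ ≤ (8 * |t| + 2) * (2 * √(T x)) := by gcongr
        _ = _ := by rw [hc₃]; ring
    have hexpT : Real.exp (T x - Real.log (T x)) = Real.exp (T x) / T x := by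
      rw [Real.exp_sub, Real.exp_log hT0]
    -- The crude bound Z exp(2a) suffices; the constant is absorbed through Z + 1 ≤ exp Z and Z ≤ a.
    have hcardF : ((primesUpTo N (Real.exp (Real.exp (T x - Real.log (T x))))).card : ℝ) + 1 ≤
        Real.exp (3 * (Real.exp (T x) / T x)) := by
      have h2 := H.card_primesUpTo_le (Real.exp (Real.exp (T x - Real.log (T x))))
      rw [hexpT] at h2 ⊢
      set a := Real.exp (T x) / T x with ha
      have ha0 : 0 < a := by positivity
      rw [← Real.exp_nat_mul] at h2
      have h3 : 1 ≤ Real.exp (2 * a) := Real.one_le_exp (by positivity)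
      calc _ ≤ Z * Real.exp (2 * a) + Real.exp (2 * a) := by
            push_cast at h2
            linarith
        _ = (Z + 1) * Real.exp (2 * a) := by ring
        _ ≤ Real.exp Z * Real.exp (2 * a) := by
            gcongr
            exact Real.add_one_le_exp Z
        _ = Real.exp (Z + 2 * a) := by rw [Real.exp_add]
        _ ≤ _ := Real.exp_le_exp.2 (by linarith)
    have hpow : (x : ℝ) ^ θ / x = Real.exp (-((1 - θ) * Real.exp (T x))) := by
      rw [hx, ← Real.exp_mul, ← Real.exp_sub]
      congr 1
      ring
    calc _ ≤ C * Real.exp (-((1 - θ) * Real.exp (T x))) *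
          Real.exp (3 * (Real.exp (T x) / T x)) ^ K x := by
          rw [mul_div_assoc, hpow]
          exact mul_le_mul_of_nonneg_left (pow_le_pow_left₀ (Nat.cast_add_one_pos _).le hcardF _)
            (mul_nonneg hC.le (Real.exp_pos _).le)
      _ = C * Real.exp (-((1 - θ) * Real.exp (T x)) + K x * (3 * (Real.exp (T x) / T x))) := by
          rw [← Real.exp_nat_mul, Real.exp_add, mul_assoc]
      _ ≤ _ := by
          gcongr
          -- Since K = O(√T), the left side is O(exp(T)/√T), which uses up at most half of the
          -- saving (1 - θ) exp T.
          have h2 : K x * (3 * (Real.exp (T x) / T x)) ≤ (1 - θ) / 2 * Real.exp (T x) := by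
            have h3 : 3 * c₃ ≤ (1 - θ) / 2 * √(T x) := by
              rw [div_le_iff₀ (by linarith)] at hxT
              linarith
            calc _ ≤ c₃ * √(T x) * (3 * (Real.exp (T x) / T x)) := by gcongr
              _ = 3 * c₃ * √(T x) / T x * Real.exp (T x) := by ring
              _ ≤ ((1 - θ) / 2 * √(T x)) * √(T x) / T x * Real.exp (T x) := by gcongr
              _ = _ := by
                rw [mul_assoc, hsqT]
                field_simp
          linarith
  have herr3 : Tendsto (fun x => (C + κ) * Real.exp (8 * |s x| * μ x - 2 * K x)) l (𝓝 0) := by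
    have h1 : Tendsto (fun x => (C + κ) * Real.exp (-√(ℓ x))) l (𝓝 ((C + κ) * 0)) :=
      (Real.tendsto_exp_neg_atTop_nhds_zero.comp hsℓ).const_mul _
    rw [mul_zero] at h1
    refine squeeze_zero' (Eventually.of_forall fun x => by positivity) ?_ h1
    have h2 := hμℓ1.eventually_le_const (show (1 : ℝ) < 2 by norm_num)
    filter_upwards [h2, hℓ1] with x hx hxℓ
    gcongr
    have h3 : 0 < √(ℓ x) := Real.sqrt_pos.2 (by linarith)
    have h4 : √(ℓ x) * √(ℓ x) = ℓ x := Real.mul_self_sqrt (by linarith)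
    rw [div_le_iff₀ (by linarith)] at hx
    have h5 : (8 * |t| + 1) * √(ℓ x) ≤ K x := Nat.le_ceil _
    have h6 : 8 * |s x| * μ x ≤ 16 * |t| * √(ℓ x) := by
      calc 8 * |s x| * μ x ≤ 8 * |s x| * (2 * ℓ x) := by gcongr
        _ = 16 * |t| / √(ℓ x) * ℓ x := by
          simp only [hs]
          rw [abs_div, abs_of_pos h3]
          ring
        _ = 16 * |t| / √(ℓ x) * (√(ℓ x) * √(ℓ x)) := by rw [h4]
        _ = _ := by field_simp
    nlinarith
  have herr4 : Tendsto (fun x => κ * (|s x| ^ 2 * Z)) l (𝓝 0) := by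
    have h1 := ((hs0.abs.pow 2).mul_const Z).const_mul κ
    simpa using h1
  have herr := ((herr1.add herr2).add herr3).add herr4
  simp only [add_zero] at herr
  have hdiff : Tendsto (fun x : ℚ => ((x : ℝ) : ℂ)⁻¹ * ∑ m ∈ box N x,
        Complex.exp (((t * ((m.support.card - ℓ x) / √(ℓ x)) : ℝ) : ℂ) * Complex.I) -
      (κ : ℂ) * Complex.exp ((Complex.exp (s x * Complex.I) - 1) * (μ x : ℂ)
      - (s x * ℓ x : ℝ) * Complex.I)) l (𝓝 0) := by
    refine squeeze_zero_norm' ?_ herr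
    filter_upwards [hxexp, hTbig, hs1, eventually_mem_atTopIn X,
      (tendsto_ratCast_atTopIn X).eventually_ge_atTop 1] with x hx hx6 hxs hxX hx1
    have hlog0 : 0 ≤ Real.log (T x) := Real.log_nonneg (by linarith)
    have h1 := H.norm_mean_exp_card_support_sub_le hxX (by exact_mod_cast hx1)
      (F := primesUpTo N (Real.exp (Real.exp (T x - Real.log (T x)))))
      (F₁ := primesUpTo N (Real.exp (Real.exp (T x))))
      (by
        intro p hp
        rw [H.mem_primesUpTo] at hp ⊢
        refine hp.trans ?_
        gcongr
        linarith)
      (fun m hm => H.support_subset hx.le hm) hxs (K x)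
    refine le_trans (le_of_eq ?_) h1
    -- Centering contributes a common unimodular factor, which disappears from the norm of the
    -- difference.
    have e1 : ∀ m : P →₀ ℕ, Complex.exp (((t * ((m.support.card - ℓ x) / √(ℓ x)) : ℝ) : ℂ)
        * Complex.I) = Complex.exp ((-(s x * ℓ x) : ℝ) * Complex.I) *
          Complex.exp (s x * m.support.card * Complex.I) := by
      intro m
      rw [← Complex.exp_add]
      congr 1
      simp only [hs]
      push_cast
      ring
    simp_rw [e1]
    rw [← Finset.mul_sum]
    have e2 : Complex.exp ((Complex.exp (s x * Complex.I) - 1) * (μ x : ℂ)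
        - (s x * ℓ x : ℝ) * Complex.I) = Complex.exp ((-(s x * ℓ x) : ℝ) * Complex.I) *
        Complex.exp ((Complex.exp (s x * Complex.I) - 1) * (μ x : ℂ)) := by
      rw [← Complex.exp_add]
      congr 1
      push_cast
      ring
    rw [e2, mul_left_comm, mul_left_comm (κ : ℂ), ← mul_sub, norm_mul,
      Complex.norm_exp_ofReal_mul_I, one_mul]
    rfl
  have := hdiff.add hmain
  rw [zero_add] at this
  refine this.congr fun x => ?_
  ring

/-! ### Restriction to h-free elements -/

instance (X : Set ℚ) : (atTopIn X).IsCountablyGenerated := by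
  unfold atTopIn
  infer_instance

/-- The number of prime divisors, normalized by `log log x`. -/
noncomputable def primeCountNormalized (x : ℚ) (m : P →₀ ℕ) : ℝ :=
  (m.support.card - Real.log (Real.log x)) / √(Real.log (Real.log x))

open Classical in
/-- The `h`-free elements of norm at most `x`, as a finite set. -/
noncomputable def hFreeBox (N : P → ℕ) (h : ℕ) (x : ℚ) : Finset (P →₀ ℕ) :=
  (box N x).filter fun m => m ∈ hFree P h

theorem tendsto_div_norm_atTopIn (H : RegularCount N X κ θ C) (e : P →₀ ℕ) :
    Tendsto (fun x : ℚ => x / norm N e) (atTopIn X) (atTopIn X) := by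
  have he : (0 : ℚ) < norm N e := by exact_mod_cast H.norm_pos e
  refine tendsto_inf.2 ⟨?_, tendsto_principal.2 ?_⟩
  · exact (tendsto_id.atTop_div_const he).mono_left inf_le_left
  · exact (eventually_mem_atTopIn X).mono fun x hx => H.div_norm_mem hx e

/-- The difference is log(1 + log D / log x). This lets the limit law on the box of size x / N(e) be
normalized by log log x. -/
theorem tendsto_log_log_mul_sub (X : Set ℚ) {D : ℚ} (hD : 0 < D) :
    Tendsto (fun x : ℚ => Real.log (Real.log ((D * x : ℚ) : ℝ)) - Real.log (Real.log x))
      (atTopIn X) (𝓝 0) := by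
  have hlog : Tendsto (fun x : ℚ => Real.log x) (atTopIn X) atTop :=
    Real.tendsto_log_atTop.comp (tendsto_ratCast_atTopIn X)
  have h1 : Tendsto (fun x : ℚ => 1 + Real.log D / Real.log x) (atTopIn X) (𝓝 (1 + 0)) :=
    (tendsto_const_nhds.div_atTop hlog).const_add 1
  rw [add_zero] at h1
  have h2 := ((Real.continuousAt_log one_ne_zero).tendsto.comp h1)
  rw [Real.log_one] at h2
  refine h2.congr' ?_
  have hD' : (0 : ℝ) < D := by exact_mod_cast hD
  filter_upwards [hlog.eventually_gt_atTop 0, hlog.eventually_gt_atTop (-Real.log D),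
    (tendsto_ratCast_atTopIn X).eventually_gt_atTop 0] with x hx hx' hx0
  simp only [Function.comp_apply]
  push_cast
  rw [Real.log_mul hD'.ne' hx0.ne', ← Real.log_div (by linarith) hx.ne']
  congr 1
  field_simp
  ring

/-- A shift by a fixed e changes the number of primes by a bounded amount, invisible after division
by √(log log x). -/
theorem abs_card_support_add_sub_le (m e : P →₀ ℕ) :
    |((m + e).support.card : ℝ) - m.support.card| ≤ e.support.card := by
  classical
  have h1 : (m + e).support.card ≤ m.support.card + e.support.card :=
    (Finset.card_le_card Finsupp.support_add).trans (Finset.card_union_le _ _)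
  have h2 : m.support.card ≤ (m + e).support.card :=
    Finset.card_le_card (Finsupp.support_mono le_self_add)
  have h1' : ((m + e).support.card : ℝ) ≤ m.support.card + e.support.card := by exact_mod_cast h1
  have h2' : (m.support.card : ℝ) ≤ (m + e).support.card := by exact_mod_cast h2
  rw [abs_le]
  constructor <;> linarith [(Nat.cast_nonneg e.support.card : (0 : ℝ) ≤ _)]

open Classical in
/-- The multiples of `e` contribute the fraction `1 / N(e)` of the limiting characteristic
function. -/
theorem RegularCount.tendsto_sum_multiples (H : RegularCount N X κ θ C) (e : P →₀ ℕ) (t : ℝ) :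
    Tendsto (fun x : ℚ => ((x : ℝ) : ℂ)⁻¹ * ∑ m ∈ (box N x).filter (fun m => e ≤ m),
        Complex.exp (((t * primeCountNormalized x m : ℝ) : ℂ) * Complex.I))
      (atTopIn X) (𝓝 ((norm N e : ℂ)⁻¹ * (κ * Complex.exp (-t ^ 2 / 2)))) := by
  have he : (0 : ℚ) < norm N e := by exact_mod_cast H.norm_pos e
  have he' : (0 : ℝ) < norm N e := by exact_mod_cast H.norm_pos e
  have hT := tendsto_log_log_atTopIn X
  -- In the variable y = x / N(e), the normalization log log x becomes log log(N(e) y).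
  have h1 := ((H.tendsto_mean_exp _ (tendsto_log_log_mul_sub X he) t).comp
    (tendsto_div_norm_atTopIn H e)).const_mul ((norm N e : ℂ)⁻¹)
  have h2 : Tendsto (fun x : ℚ => |t| * e.support.card * C / √(Real.log (Real.log x))) (atTopIn X)
      (𝓝 0) := tendsto_const_nhds.div_atTop (Real.tendsto_sqrt_atTop.comp hT)
  have h3 : Tendsto (fun x : ℚ => ((x : ℝ) : ℂ)⁻¹ * ∑ m ∈ (box N x).filter (fun m => e ≤ m),
        Complex.exp (((t * primeCountNormalized x m : ℝ) : ℂ) * Complex.I) -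
      ((x : ℝ) : ℂ)⁻¹ * ∑ m ∈ box N (x / norm N e),
        Complex.exp (((t * primeCountNormalized x m : ℝ) : ℂ) * Complex.I)) (atTopIn X) (𝓝 0) := by
    refine squeeze_zero_norm' ?_ h2
    filter_upwards [eventually_mem_atTopIn X, (tendsto_ratCast_atTopIn X).eventually_gt_atTop 0,
      hT.eventually_gt_atTop 0] with x hxX hx0 hxT
    rw [H.sum_box_filter_le, ← mul_sub, ← Finset.sum_sub_distrib, norm_mul, norm_inv,
      Complex.norm_real, Real.norm_of_nonneg hx0.le]
    have hs : 0 < √(Real.log (Real.log x)) := Real.sqrt_pos.2 hxT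
    have h4 : ∀ m : P →₀ ℕ,
        ‖Complex.exp (((t * primeCountNormalized x (m + e) : ℝ) : ℂ) * Complex.I) -
          Complex.exp (((t * primeCountNormalized x m : ℝ) : ℂ) * Complex.I)‖ ≤
        |t| * e.support.card / √(Real.log (Real.log x)) := by
      intro m
      refine (norm_exp_mul_I_sub_exp_mul_I_le _ _).trans ?_
      rw [← mul_sub, abs_mul, mul_div_assoc, primeCountNormalized, primeCountNormalized, ← sub_div,
        sub_sub_sub_cancel_right, abs_div, abs_of_pos hs]
      gcongr
      exact abs_card_support_add_sub_le m e
    have h5 := H.card_box_div_le hxX (by exact_mod_cast hx0) e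
    have h6 : (1 : ℝ) ≤ norm N e := by exact_mod_cast H.norm_pos e
    calc _ ≤ (x : ℝ)⁻¹ * ((box N (x / norm N e)).card *
          (|t| * e.support.card / √(Real.log (Real.log x)))) := by
          gcongr
          refine (norm_sum_le_of_le _ fun m _ => h4 m).trans (le_of_eq ?_)
          rw [Finset.sum_const, nsmul_eq_mul]
      _ ≤ (x : ℝ)⁻¹ * (C * x * (|t| * e.support.card / √(Real.log (Real.log x)))) := by
          gcongr
          refine h5.trans ?_
          have := H.const_pos
          gcongr
          exact div_le_self hx0.le h6
      _ = _ := by field_simp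
  have h7 := h3.add h1
  rw [zero_add] at h7
  refine h7.congr fun x => ?_
  simp only [Function.comp_apply]
  rw [mul_div_cancel₀ _ he.ne']
  have e1 : (norm N e : ℂ)⁻¹ * ((((x / norm N e : ℚ) : ℝ) : ℂ)⁻¹) = ((x : ℝ) : ℂ)⁻¹ := by
    have : (norm N e : ℂ) ≠ 0 := by exact_mod_cast he'.ne'
    push_cast
    rw [inv_div]
    field_simp
  rw [← mul_assoc, e1]
  simp only [primeCountNormalized]
  ring

open Classical in
/-- Möbius inversion for the indicator function of the `h`-free elements. -/
theorem RegularCount.sum_hFreeBox (H : RegularCount N X κ θ C) {h : ℕ} (hh : h ≠ 0) (x : ℚ)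
    (f : (P →₀ ℕ) → ℂ) :
    ∑ m ∈ hFreeBox N h x, f m =
      ∑' d : Finset P, (-1) ^ d.card * ∑ m ∈ (box N x).filter (fun m => constOn d h ≤ m), f m := by
  obtain ⟨U, hU⟩ : ∃ U : Finset P, ∀ m ∈ box N x, m.support ⊆ U :=
    ⟨primesUpTo N x, fun m hm => H.support_subset le_rfl hm⟩
  have hsupp : ∀ {m : P →₀ ℕ} {d : Finset P}, constOn d h ≤ m → d ⊆ m.support := by
    intro m d hmd p hp
    rw [constOn_le_iff] at hmd
    rw [Finsupp.mem_support_iff]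
    have := hmd p hp
    omega
  -- For fixed x only finitely many d matter. Summing over all finite sets of primes keeps the index
  -- set independent of x, as dominated convergence requires.
  rw [tsum_eq_sum (s := U.powerset)]
  · simp_rw [Finset.sum_filter, Finset.mul_sum]
    rw [Finset.sum_comm, hFreeBox, Finset.sum_filter]
    refine Finset.sum_congr rfl fun m hm => ?_
    set G := m.support.filter fun p => h ≤ m p with hG
    have h1 : ∑ d ∈ U.powerset, (-1 : ℂ) ^ d.card * (if constOn d h ≤ m then f m else 0) =
        (∑ d ∈ G.powerset, (-1 : ℂ) ^ d.card) * f m := by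
      simp_rw [mul_ite, mul_zero]
      rw [← Finset.sum_filter, Finset.sum_mul]
      refine Finset.sum_congr ?_ fun _ _ => rfl
      ext d
      rw [Finset.mem_filter, Finset.mem_powerset, Finset.mem_powerset]
      constructor
      · rintro ⟨-, hd⟩ p hp
        rw [hG, Finset.mem_filter]
        exact ⟨hsupp hd hp, (constOn_le_iff _ _ _).1 hd p hp⟩
      · intro hd
        have h2 : constOn d h ≤ m := (constOn_le_iff _ _ _).2 fun p hp =>
          (Finset.mem_filter.1 (hd hp)).2
        exact ⟨(hsupp h2).trans (hU m hm), h2⟩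
    rw [h1]
    -- G is the set of primes of multiplicity at least h; the alternating sum over its subsets
    -- detects whether it is empty.
    have h3 : ∑ d ∈ G.powerset, (-1 : ℂ) ^ d.card = if G = ∅ then 1 else 0 := by
      have := congrArg (Int.cast : ℤ → ℂ) (Finset.sum_powerset_neg_one_pow_card (x := G))
      push_cast at this
      exact this
    rw [h3, ite_mul, one_mul, zero_mul]
    refine if_congr ?_ rfl rfl
    rw [hG, Finset.filter_eq_empty_iff]
    simp only [hFree, Set.mem_ofPred_eq, not_le]
  · intro d hd
    rw [Finset.sum_eq_zero, mul_zero]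
    intro m hm
    rw [Finset.mem_filter] at hm
    exact absurd (Finset.mem_powerset.2 ((hsupp hm.2).trans (hU m hm.1))) hd

theorem RegularCount.summable_inv_pow (H : RegularCount N X κ θ C) {h : ℕ} (hh : 2 ≤ h) :
    Summable fun p : P => ((N p : ℝ)⁻¹) ^ h :=
  H.summable_prime_sq.of_nonneg_of_le (fun p => by positivity) fun p =>
    pow_le_pow_of_le_one (H.inv_nonneg_le_one p).1 (H.inv_nonneg_le_one p).2 hh

/-- The characteristic function of the number of prime divisors on the `h`-free elements. -/
theorem RegularCount.exists_tendsto_sum_hFreeBox (H : RegularCount N X κ θ C) {h : ℕ}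
    (hh : 2 ≤ h) : ∃ c : ℂ, c ≠ 0 ∧ ∀ t : ℝ,
    Tendsto (fun x : ℚ => ((x : ℝ) : ℂ)⁻¹ * ∑ m ∈ hFreeBox N h x,
        Complex.exp (((t * primeCountNormalized x m : ℝ) : ℂ) * Complex.I))
      (atTopIn X) (𝓝 (c * Complex.exp (-t ^ 2 / 2))) := by
  classical
  have hsum := H.summable_inv_pow hh
  set f : P → ℂ := fun p => -((((N p : ℝ)⁻¹) ^ h : ℝ) : ℂ) with hf
  have hnorm : ∀ p, ‖f p‖ = ((N p : ℝ)⁻¹) ^ h := by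
    intro p
    simp only [hf]
    rw [norm_neg, Complex.norm_real, Real.norm_of_nonneg (by positivity)]
  have hfs : Summable fun p => ‖f p‖ := by simpa only [hnorm] using hsum
  have hinv : ∀ d : Finset P, (norm N (constOn d h) : ℝ)⁻¹ = ∏ p ∈ d, ((N p : ℝ)⁻¹) ^ h := by
    intro d
    rw [norm_constOn]
    push_cast
    rw [← Finset.prod_inv_distrib]
    simp
  have hprod : ∀ d : Finset P, ∏ p ∈ d, f p = (-1) ^ d.card * (norm N (constOn d h) : ℂ)⁻¹ := by
    intro d
    have h1 := congrArg (Complex.ofReal) (hinv d)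
    push_cast at h1
    rw [h1, Finset.prod_neg]
    push_cast
    rfl
  -- This constant is κ times the product of the 1 - N(p)^(-h), nonzero because the product
  -- converges absolutely and no factor vanishes.
  refine ⟨(∑' d : Finset P, ∏ p ∈ d, f p) * κ, mul_ne_zero ?_ ?_, ?_⟩
  · rw [← tprod_one_add (summable_finsetProd_of_summable_norm hfs)]
    refine tprod_one_add_ne_zero_of_summable (fun p => ?_) hfs
    intro h0
    have h1 : ‖f p‖ = 1 := by
      rw [← norm_neg, ← eq_neg_of_add_eq_zero_left h0, norm_one]
    rw [hnorm] at h1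
    have h2 : (N p : ℝ)⁻¹ < 1 := inv_lt_one_of_one_lt₀ (by linarith [H.two_le p])
    have h3 := pow_lt_one₀ (H.inv_nonneg_le_one p).1 h2 (show h ≠ 0 by omega)
    linarith
  · exact_mod_cast H.dens_pos.ne'
  intro t
  simp_rw [H.sum_hFreeBox (show h ≠ 0 by omega), ← tsum_mul_left]
  rw [mul_assoc, ← tsum_mul_right]
  refine tendsto_tsum_of_dominated_convergence
    (bound := fun d : Finset P => C * ∏ p ∈ d, ((N p : ℝ)⁻¹) ^ h) ?_ ?_ ?_
  · exact (summable_finsetProd_of_summable_nonneg (fun p => by positivity) hsum).mul_left C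
  · intro d
    have h1 := (H.tendsto_sum_multiples (constOn d h) t).const_mul ((-1 : ℂ) ^ d.card)
    rw [← mul_assoc, ← hprod] at h1
    refine h1.congr fun x => ?_
    ring
  · filter_upwards [eventually_mem_atTopIn X, (tendsto_ratCast_atTopIn X).eventually_gt_atTop 0]
      with x hxX hx0 d
    have h1 := H.card_box_div_le hxX (by exact_mod_cast hx0) (constOn d h)
    rw [norm_mul, norm_mul, norm_inv, Complex.norm_real, Real.norm_of_nonneg hx0.le, norm_pow,
      norm_neg, norm_one, one_pow, one_mul, ← hinv]
    calc _ ≤ (x : ℝ)⁻¹ * (box N (x / norm N (constOn d h))).card := by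
          gcongr
          refine (norm_sum_le_of_le _ (n := fun _ => (1 : ℝ)) fun m _ => ?_).trans (le_of_eq ?_)
          · rw [Complex.norm_exp_ofReal_mul_I]
          · rw [Finset.sum_const, nsmul_eq_mul, mul_one, H.card_box_filter_le]
      _ ≤ (x : ℝ)⁻¹ * (C * (x / norm N (constOn d h))) := by gcongr
      _ = _ := by field_simp

/-! ### Generalized omega functions and the change of normalization -/

/-- The generalized omega function as a sum over the support. -/
theorem omegaSeq_eq_sum (A : ℕ → ℂ) (m : P →₀ ℕ) : omegaSeq A m = ∑ p ∈ m.support, A (m p) := by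
  classical
  rw [omegaSeq]
  change ∑ᶠ (k : ℕ) (_ : k ∈ {k : ℕ | 1 ≤ k}), A k * (omegaMult k m : ℂ) = _
  rw [finsum_mem_eq_sum_of_inter_support_eq (t := m.support.image m)]
  · rw [Finset.sum_comp A m]
    refine Finset.sum_congr rfl fun k _ => ?_
    rw [nsmul_eq_mul, mul_comm]
    rfl
  · ext k
    simp only [Set.mem_inter_iff, Set.mem_ofPred_eq, Function.mem_support, Finset.coe_image,
      Set.mem_image, Finset.mem_coe, and_congr_left_iff]
    intro hk
    have hne : omegaMult k m ≠ 0 := by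
      intro h0
      exact hk (by simp [h0])
    obtain ⟨p, hp⟩ := Finset.card_pos.mp (Nat.pos_of_ne_zero hne)
    rw [Finset.mem_filter] at hp
    have hp1 := Finsupp.mem_support_iff.1 hp.1
    exact ⟨fun _ => ⟨p, hp.1, hp.2⟩, fun _ => by omega⟩

/-- On `h`-free elements a generalized omega function differs from the number of prime divisors
by a bounded multiple of the number of repeated prime divisors. -/
theorem exists_norm_omegaSeq_sub_le {A : ℕ → ℂ} (hA : A 1 ≠ 0) (h : ℕ) :
    ∃ c : ℝ, 0 ≤ c ∧ ∀ m ∈ hFree P h, ‖1 / A 1 * omegaSeq A m - m.support.card‖ ≤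
      c * (m.support.filter fun p => 2 ≤ m p).card := by
  classical
  -- Primes of multiplicity one cancel exactly, and only finitely many other multiplicities, all
  -- below h, can occur.
  refine ⟨∑ k ∈ Finset.range h, ‖1 / A 1 * A k - 1‖, Finset.sum_nonneg fun _ _ => norm_nonneg _, ?_⟩
  intro m hm
  have e : 1 / A 1 * omegaSeq A m - m.support.card = ∑ p ∈ m.support, (1 / A 1 * A (m p) - 1) := by
    rw [omegaSeq_eq_sum, Finset.sum_sub_distrib, Finset.mul_sum]
    simp
  rw [e, Finset.card_filter, Nat.cast_sum, Finset.mul_sum]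
  refine norm_sum_le_of_le _ fun p hp => ?_
  have hp0 := Finsupp.mem_support_iff.1 hp
  split_ifs with h2
  · rw [Nat.cast_one, mul_one]
    exact Finset.single_le_sum (f := fun k => ‖1 / A 1 * A k - 1‖) (fun _ _ => norm_nonneg _)
      (Finset.mem_range.2 (hm p hp))
  · have : m p = 1 := by omega
    rw [this]
    simp [hA]

/-- The first moment of the number of repeated prime divisors. -/
theorem RegularCount.sum_box_card_repeated_le (H : RegularCount N X κ θ C) {x : ℚ} (hx : x ∈ X)
    (hx0 : 0 < x) :
    ∑ m ∈ box N x, ((m.support.filter fun p => 2 ≤ m p).card : ℝ) ≤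
      C * x * ∑' p : P, ((N p : ℝ)⁻¹) ^ 2 := by
  classical
  have hx0' : (0 : ℝ) < x := by exact_mod_cast hx0
  set F := primesUpTo N x with hF
  calc _ ≤ ∑ m ∈ box N x, ∑ p ∈ F, (if constOn {p} 2 ≤ m then 1 else 0 : ℝ) := by
        refine Finset.sum_le_sum fun m hm => ?_
        rw [Finset.sum_boole]
        refine Nat.cast_le.2 (Finset.card_le_card fun p hp => ?_)
        rw [Finset.mem_filter] at hp ⊢
        refine ⟨H.support_subset le_rfl hm hp.1, ?_⟩
        rw [constOn_le_iff]
        simpa using hp.2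
    _ = ∑ p ∈ F, ((box N (x / norm N (constOn {p} 2))).card : ℝ) := by
        rw [Finset.sum_comm]
        refine Finset.sum_congr rfl fun p _ => ?_
        rw [Finset.sum_boole, H.card_box_filter_le]
    _ ≤ ∑ p ∈ F, C * x * ((N p : ℝ)⁻¹) ^ 2 := by
        refine Finset.sum_le_sum fun p _ => (H.card_box_div_le hx hx0 _).trans (le_of_eq ?_)
        rw [norm_constOn]
        simp
        ring
    _ ≤ _ := by
        rw [← Finset.mul_sum]
        have := H.const_pos
        gcongr
        exact H.summable_prime_sq.sum_le_tsum _ fun p _ => by positivity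

/-- Comparison of normalizations by nearby quantities `a ^ 2` and `b ^ 2`. -/
theorem abs_normalization_sub_le {a b ω e E : ℝ} (ha : 2 ≤ a) (hb : b ≤ a) (hb0 : 0 ≤ b)
    (hab : a ^ 2 - b ^ 2 ≤ 1) (hω : 0 ≤ ω) (he : |e| ≤ E) :
    |(ω + e - b ^ 2) / b - (ω - a ^ 2) / a| ≤ (2 * E + 1 + 2 * (ω / a ^ 2)) / a := by
  have hba : a / 2 ≤ b := by nlinarith
  have hbpos : 0 < b := by linarith
  have hapos : 0 < a := by linarith
  have hd : a - b ≤ 1 / a := by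
    rw [le_div_iff₀ hapos]
    nlinarith
  have hbinv : 1 / b ≤ 2 / a := by
    rw [div_le_div_iff₀ hbpos hapos]
    linarith
  have e1 : (ω + e - b ^ 2) / b - (ω - a ^ 2) / a =
      e * (1 / b) + ω * (1 / a) * (1 / b) * (a - b) + (a - b) := by
    field_simp
    ring
  rw [e1]
  have hE : 0 ≤ E := (abs_nonneg e).trans he
  have h1 : |e * (1 / b)| ≤ E * (2 / a) := by
    rw [abs_mul, abs_of_pos (by positivity : 0 < 1 / b)]
    gcongr
  have h2 : |ω * (1 / a) * (1 / b) * (a - b)| ≤ ω * (1 / a) * (2 / a) * (1 / a) := by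
    rw [abs_of_nonneg (mul_nonneg (by positivity) (by linarith))]
    gcongr
  have h3 : |a - b| ≤ 1 / a := by rwa [abs_of_nonneg (by linarith)]
  calc _ ≤ E * (2 / a) + ω * (1 / a) * (2 / a) * (1 / a) + 1 / a :=
        (abs_add_le _ _).trans (add_le_add ((abs_add_le _ _).trans (add_le_add h1 h2)) h3)
    _ = _ := by
      field_simp
      ring

/-- The number of elements of norm at most `√x` is `O(x ^ (3 / 4))`. -/
theorem RegularCount.exists_card_filter_sq_le (H : RegularCount N X κ θ C) :
    ∃ c : ℝ, 0 < c ∧ ∀ x : ℚ, 0 < x →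
      (((box N x).filter fun m => ((norm N m : ℕ) : ℚ) ^ 2 ≤ x).card : ℝ) ≤
        c * (x : ℝ) ^ (3 / 4 : ℝ) := by
  obtain ⟨c, hc, hcb⟩ := H.exists_sum_rpow_le
  -- Since √x need not lie in X, Rankin's trick at exponent 3/2 replaces a direct count: 1 ≤
  -- N(m)^(-3/2) x^(3/4) when N(m)² ≤ x.
  refine ⟨c / (1 / 2), by positivity, ?_⟩
  intro x hx
  have hx0 : (0 : ℝ) < x := by exact_mod_cast hx
  rw [← mul_one (Nat.cast _), ← nsmul_eq_mul, ← Finset.sum_const]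
  refine le_trans ?_ (mul_le_mul_of_nonneg_right (hcb (1 / 2) (by norm_num) (by norm_num)
    ((box N x).filter fun m => ((norm N m : ℕ) : ℚ) ^ 2 ≤ x)) (Real.rpow_nonneg hx0.le _))
  rw [Finset.sum_mul]
  refine Finset.sum_le_sum fun m hm => ?_
  have hm1 : ((norm N m : ℕ) : ℝ) ^ 2 ≤ x := by exact_mod_cast (Finset.mem_filter.1 hm).2
  have hn : (0 : ℝ) < norm N m := by exact_mod_cast H.norm_pos m
  have h1 : (((norm N m : ℕ) : ℝ) ^ 2) ^ (3 / 4 : ℝ) ≤ (x : ℝ) ^ (3 / 4 : ℝ) :=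
    Real.rpow_le_rpow (by positivity) hm1 (by norm_num)
  rw [← Real.rpow_natCast, ← Real.rpow_mul hn.le] at h1
  calc (1 : ℝ) = (norm N m : ℝ) ^ (-(1 + 1 / 2) : ℝ) *
        (norm N m : ℝ) ^ (((2 : ℕ) : ℝ) * (3 / 4)) := by
        rw [← Real.rpow_add hn]
        norm_num
    _ ≤ _ := by gcongr

/-- Away from the elements of small norm, normalizing by `log log N(m)` or `log log x` makes
little difference. -/
theorem RegularCount.tendsto_sum_hFreeBox_sub (H : RegularCount N X κ θ C) {h : ℕ} {A : ℕ → ℂ}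
    (hA : A 1 ≠ 0) {Y : (P →₀ ℕ) → ℝ}
    (hY : ∀ m, 3 ≤ norm N m → Y m = (normalized N (fun m => 1 / A 1 * omegaSeq A m) m).re)
    (t : ℝ) :
    Tendsto (fun x : ℚ => ((x : ℝ) : ℂ)⁻¹ * ∑ m ∈ hFreeBox N h x,
        (Complex.exp (((t * Y m : ℝ) : ℂ) * Complex.I) -
          Complex.exp (((t * primeCountNormalized x m : ℝ) : ℂ) * Complex.I)))
      (atTopIn X) (𝓝 0) := by
  classical
  obtain ⟨cA, hcA, hcAb⟩ := exists_norm_omegaSeq_sub_le (P := P) hA h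
  obtain ⟨c, hc, hcb⟩ := H.exists_card_filter_sq_le
  obtain ⟨c', hc', hmert⟩ := H.exists_abs_recipSum_sub_le
  have hC := H.const_pos
  have hT := tendsto_log_log_atTopIn X
  have hX := tendsto_ratCast_atTopIn X
  set Z := ∑' p : P, ((N p : ℝ)⁻¹) ^ 2 with hZ
  have hZ0 : 0 ≤ Z := tsum_nonneg fun p => by positivity
  set D := |t| * (2 * cA * (C * Z) + C + 2 * (C * (1 + c'))) with hD
  have hlim1 : Tendsto (fun x : ℚ => 2 * c * (x : ℝ) ^ (-(1 / 4) : ℝ)) (atTopIn X) (𝓝 0) := by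
    have := ((tendsto_rpow_neg_atTop (y := 1 / 4) (by norm_num)).comp hX).const_mul (2 * c)
    rwa [mul_zero] at this
  have hlim2 : Tendsto (fun x : ℚ => D / √(Real.log (Real.log x))) (atTopIn X) (𝓝 0) :=
    tendsto_const_nhds.div_atTop (Real.tendsto_sqrt_atTop.comp hT)
  have hlim := hlim1.add hlim2
  rw [add_zero] at hlim
  refine squeeze_zero_norm' ?_ hlim
  -- With x ≥ 9, any m with N(m)² > x has norm above 3, where Y is given by the formula; log log x ≥
  -- 4 gives the bound 2 ≤ √T for the comparison of normalizations.
  filter_upwards [eventually_mem_atTopIn X, hX.eventually_ge_atTop 9,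
    hT.eventually_ge_atTop 4] with x hxX hx9 hxT
  have hx0 : (0 : ℝ) < x := by linarith
  have hx0q : 0 < x := by exact_mod_cast hx0
  set T := Real.log (Real.log x) with hTdef
  have hsq : √T ^ 2 = T := Real.sq_sqrt (by linarith)
  have hs2 : 2 ≤ √T := Real.le_sqrt_of_sq_le (by linarith)
  have hlogx : 0 < Real.log x := Real.log_pos (by linarith)
  have hterm : ∀ m ∈ hFreeBox N h x,
      ‖Complex.exp (((t * Y m : ℝ) : ℂ) * Complex.I) -
          Complex.exp (((t * primeCountNormalized x m : ℝ) : ℂ) * Complex.I)‖ ≤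
        2 * (if ((norm N m : ℕ) : ℚ) ^ 2 ≤ x then 1 else 0) +
        |t| * ((2 * (cA * (m.support.filter fun p => 2 ≤ m p).card) + 1 +
          2 * (m.support.card / T)) / √T) := by
    intro m hm
    rw [hFreeBox, Finset.mem_filter, H.mem_box] at hm
    have hnn : 0 ≤ |t| * ((2 * (cA * (m.support.filter fun p => 2 ≤ m p).card) + 1 +
          2 * (m.support.card / T)) / √T) := by
      have : 0 ≤ T := by linarith
      positivity
    split_ifs with hsmall
    · refine (norm_sub_le _ _).trans ?_
      rw [Complex.norm_exp_ofReal_mul_I, Complex.norm_exp_ofReal_mul_I]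
      linarith
    · rw [mul_zero, zero_add]
      refine (norm_exp_mul_I_sub_exp_mul_I_le _ _).trans ?_
      rw [← mul_sub, abs_mul]
      refine mul_le_mul_of_nonneg_left ?_ (abs_nonneg t)
      have hbig : (x : ℝ) < (norm N m : ℝ) ^ 2 := by exact_mod_cast not_le.1 hsmall
      have hle : (norm N m : ℝ) ≤ x := by exact_mod_cast hm.1
      have hn0 : (0 : ℝ) < norm N m := by exact_mod_cast H.norm_pos m
      have hn3 : (3 : ℝ) < norm N m := by nlinarith
      rw [hY m (by exact_mod_cast hn3.le)]
      set L := Real.log (Real.log (norm N m)) with hL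
      have hlogn : 1 / 2 * Real.log x ≤ Real.log (norm N m) := by
        have := Real.log_le_log hx0 hbig.le
        rw [Real.log_pow] at this
        push_cast at this
        linarith
      have hlogn0 : 0 < Real.log (norm N m) := by linarith
      have hLT : L ≤ T := Real.log_le_log hlogn0 (Real.log_le_log hn0 hle)
      -- From N(m)² > x one loses at most log 2 < 1 in the double logarithm.
      have hTL : T - 1 ≤ L := by
        have h1 := Real.log_le_log (by positivity) hlogn
        rw [Real.log_mul (by norm_num) hlogx.ne', one_div, Real.log_inv] at h1
        have h2 := Real.log_two_lt_d9
        rw [hTdef, hL]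
        linarith
      have hLsq : √L ^ 2 = L := Real.sq_sqrt (by linarith)
      set g := 1 / A 1 * omegaSeq A m with hg
      have hre : (normalized N (fun m => 1 / A 1 * omegaSeq A m) m).re =
          (m.support.card + (g - m.support.card).re - √L ^ 2) / √L := by
        change ((g - (L : ℂ)) / (√L : ℂ)).re = _
        rw [hLsq, Complex.div_ofReal_re, Complex.sub_re, Complex.sub_re, Complex.ofReal_re,
          Complex.natCast_re, add_sub_cancel]
      rw [hre, primeCountNormalized, ← hTdef]
      have h3 := abs_normalization_sub_le (a := √T) (b := √L) (ω := m.support.card)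
        (e := (g - m.support.card).re) (E := cA * (m.support.filter fun p => 2 ≤ m p).card) hs2
        (Real.sqrt_le_sqrt hLT) (Real.sqrt_nonneg _) (by rw [hsq, hLsq]; linarith)
        (Nat.cast_nonneg _) ((Complex.abs_re_le_norm _).trans (hcAb m hm.2))
      rwa [hsq] at h3
  have hsumω : ∑ m ∈ box N x, (m.support.card : ℝ) ≤ C * x * ((1 + c') * T) := by
    have h1 := H.sum_box_card_filter_le hxX hx0q (primesUpTo N (Real.exp (Real.exp T)))
    have h2 := (abs_le.1 (hmert T (by linarith))).2
    have h3 : Real.log T ≤ T := by linarith [Real.log_le_sub_one_of_pos (by linarith : 0 < T)]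
    calc _ = ∑ m ∈ box N x, ((((primesUpTo N (Real.exp (Real.exp T))).filter
            fun p => p ∈ m.support).card : ℕ) : ℝ) := by
          refine Finset.sum_congr rfl fun m hm => ?_
          have hxT' : (x : ℝ) = Real.exp (Real.exp T) := by
            rw [hTdef, Real.exp_log hlogx, Real.exp_log hx0]
          congr 2
          ext p
          rw [Finset.mem_filter]
          exact ⟨fun hp => ⟨H.support_subset hxT'.le hm hp, hp⟩, fun hp => hp.2⟩
      _ ≤ C * x * recipSum N T := h1
      _ ≤ _ := by
          gcongr
          nlinarith
  have hrep := H.sum_box_card_repeated_le hxX hx0q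
  have hcard := H.card_le x hxX hx0q
  have hsub : hFreeBox N h x ⊆ box N x := Finset.filter_subset _ _
  have hT0 : 0 < T := by linarith
  rw [norm_mul, norm_inv, Complex.norm_real, Real.norm_of_nonneg hx0.le]
  calc _ ≤ (x : ℝ)⁻¹ * ∑ m ∈ box N x, (2 * (if ((norm N m : ℕ) : ℚ) ^ 2 ≤ x then 1 else 0) +
        |t| * ((2 * (cA * (m.support.filter fun p => 2 ≤ m p).card) + 1 +
          2 * (m.support.card / T)) / √T)) := by
        gcongr
        refine (norm_sum_le_of_le _ hterm).trans
          (Finset.sum_le_sum_of_subset_of_nonneg hsub fun m _ _ => ?_)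
        have h1 : (0 : ℝ) ≤ if ((norm N m : ℕ) : ℚ) ^ 2 ≤ x then 1 else 0 := by
          split_ifs <;> norm_num
        positivity
    _ = (x : ℝ)⁻¹ * (2 * ((box N x).filter fun m => ((norm N m : ℕ) : ℚ) ^ 2 ≤ x).card +
        |t| * ((2 * (cA * ∑ m ∈ box N x, ((m.support.filter fun p => 2 ≤ m p).card : ℝ)) +
          (box N x).card + 2 * ((∑ m ∈ box N x, (m.support.card : ℝ)) / T)) / √T)) := by
        rw [Finset.sum_add_distrib, ← Finset.mul_sum, Finset.sum_boole, ← Finset.mul_sum,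
          ← Finset.sum_div, Finset.sum_add_distrib, Finset.sum_add_distrib, ← Finset.mul_sum,
          ← Finset.mul_sum, ← Finset.mul_sum, ← Finset.sum_div]
        simp
    _ ≤ (x : ℝ)⁻¹ * (2 * (c * (x : ℝ) ^ (3 / 4 : ℝ)) +
        |t| * ((2 * (cA * (C * x * Z)) + C * x + 2 * ((C * x * ((1 + c') * T)) / T)) / √T)) := by
        gcongr
        exact hcb x hx0q
    _ = _ := by
        have e1 : (x : ℝ) ^ (3 / 4 : ℝ) = x * (x : ℝ) ^ (-(1 / 4) : ℝ) := by
          nth_rewrite 2 [← Real.rpow_one (x : ℝ)]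
          rw [← Real.rpow_add hx0]
          norm_num
        rw [e1, hD]
        have : 0 < √T := by linarith
        field_simp

/-! ### Conclusion -/

/-- The distribution of a generalized omega function on `h`-free elements. -/
theorem RegularCount.tendsto_card_hFreeBox_filter (H : RegularCount N X κ θ C) {h : ℕ}
    (hh : 2 ≤ h) {A : ℕ → ℂ} (hA : A 1 ≠ 0) {Y : (P →₀ ℕ) → ℝ}
    (hY : ∀ m, 3 ≤ norm N m → Y m = (normalized N (fun m => 1 / A 1 * omegaSeq A m) m).re)
    (a : ℝ) :
    Tendsto (fun x : ℚ => (((hFreeBox N h x).filter fun m => Y m ≤ a).card : ℝ) /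
      (hFreeBox N h x).card) (atTopIn X) (𝓝 (Phi a)) := by
  classical
  obtain ⟨c, hc, hlim⟩ := H.exists_tendsto_sum_hFreeBox hh
  have hX := tendsto_ratCast_atTopIn X
  refine tendsto_card_filter_le_div _ ?_ Y (fun t => ?_) a
  · filter_upwards [hX.eventually_ge_atTop 1] with x hx
    refine ⟨0, ?_⟩
    rw [hFreeBox, Finset.mem_filter, H.mem_box, norm_zero]
    exact ⟨by exact_mod_cast hx, by simp [hFree]⟩
  -- At t = 0 the exponential sum counts the h-free elements, so dividing by this limit turns means
  -- over x into means over the sample.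
  · have h0 := hlim 0
    have h1 := (H.tendsto_sum_hFreeBox_sub (h := h) hA hY t).add (hlim t)
    have h2 := h1.div h0 (by simpa using hc)
    have e : (0 + c * Complex.exp (-t ^ 2 / 2)) / (c * Complex.exp (-(0 : ℝ) ^ 2 / 2)) =
        Complex.exp (-t ^ 2 / 2) := by
      simp [hc]
    rw [e] at h2
    refine h2.congr' ?_
    filter_upwards [hX.eventually_ge_atTop 1] with x hx
    have hx0 : ((x : ℝ) : ℂ) ≠ 0 := by
      rw [Complex.ofReal_ne_zero]
      linarith
    rw [Pi.div_apply, ← mul_add, Finset.sum_sub_distrib, sub_add_cancel]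
    simp only [zero_mul, Complex.ofReal_zero, Complex.exp_zero, Finset.sum_const, nsmul_eq_mul,
      mul_one]
    rw [mul_div_mul_left _ _ (inv_ne_zero hx0), div_eq_inv_mul]
    push_cast
    rfl

end AbelianMonoid

theorem theorem1p8 {P : Type*} [Countable P] (N : P → ℕ) (hN : ∀ p, 1 < N p)
    (X : Set ℚ) (hX : AbelianMonoid.IsRange N X)
    (hstar : AbelianMonoid.CountingCondition N X)
    (h : ℕ) (hh : 2 ≤ h)
    (A : ℕ → ℂ) (hA1 : A 1 ≠ 0)
    (B α : ℝ) (hα : 0 < α) (hB0 : 0 < B) (hB : B ≤ (2 : ℝ) ^ (1 - α))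
    (hA : A =O[atTop] fun i : ℕ => B ^ i) (a : ℝ) :
    Tendsto
      (fun x : ℚ =>
        1 / ((AbelianMonoid.upTo N (AbelianMonoid.hFree P h) x).ncard : ℝ) *
          ({m | m ∈ AbelianMonoid.upTo N (AbelianMonoid.hFree P h) x ∧
              3 ≤ AbelianMonoid.norm N m ∧
              (AbelianMonoid.normalized N
                (fun m => 1 / A 1 * AbelianMonoid.omegaSeq A m) m).re ≤ a}.ncard : ℝ))
      (AbelianMonoid.atTopIn X) (𝓝 (AbelianMonoid.Phi a)) := by
  classical
  -- If X is bounded above, the filter is trivial and there is nothing to prove.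
  rcases (AbelianMonoid.atTopIn X).eq_or_neBot with hbot | hne
  · rw [hbot]
    exact tendsto_bot
  obtain ⟨κ, θ, C, H⟩ := AbelianMonoid.exists_regularCount hN hX hstar
  -- The default value a + 1 excludes the elements of norm below 3 from the event Y ≤ a.
  let Y : (P →₀ ℕ) → ℝ := fun m => if 3 ≤ AbelianMonoid.norm N m then
    (AbelianMonoid.normalized N (fun m => 1 / A 1 * AbelianMonoid.omegaSeq A m) m).re else a + 1
  have hlim := H.tendsto_card_hFreeBox_filter hh hA1 (Y := Y) (fun m hm => if_pos hm) a
  refine hlim.congr fun x => ?_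
  have h1 : AbelianMonoid.upTo N (AbelianMonoid.hFree P h) x =
      (AbelianMonoid.hFreeBox N h x : Set (P →₀ ℕ)) := by
    ext m
    rw [Finset.mem_coe, AbelianMonoid.hFreeBox, Finset.mem_filter, H.mem_box, and_comm]
    rfl
  have h2 : {m | m ∈ AbelianMonoid.upTo N (AbelianMonoid.hFree P h) x ∧
      3 ≤ AbelianMonoid.norm N m ∧ (AbelianMonoid.normalized N
        (fun m => 1 / A 1 * AbelianMonoid.omegaSeq A m) m).re ≤ a} =
      ((AbelianMonoid.hFreeBox N h x).filter fun m => Y m ≤ a : Finset (P →₀ ℕ)) := by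
    ext m
    rw [Set.mem_ofPred_eq, h1, Finset.coe_filter, Set.mem_ofPred_eq, Finset.mem_coe]
    refine and_congr_right fun _ => ?_
    by_cases h3 : 3 ≤ AbelianMonoid.norm N m
    · simp [Y, h3]
    · simp [Y, h3]
  rw [h2, h1, Set.ncard_coe_finset, Set.ncard_coe_finset, one_div, div_eq_inv_mul]
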